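/- Let $\mathbf{Sol}$ be $\mathbb R^3$ with the group law $(a,b,c)(x,y,z)=(x+ae^{-z},\,y+be^{z},\,z+c)$, with the metric $ds^2=e^{2z}dx^2+e^{-2z}dy^2+dz^2$, which is invariant under the translations $p\mapsto pg$, and with the volume $dx\,dy\,dz$. A translation curve is a solution of $\dot x=ue^{-z},\ \dot y=ve^{z},\ \dot z=w$ with constant $u,v,w$. The translation distance $d^t(p,q)$ is the arc length of the translation curve from $p$ to $q$, and $B(c,r)=\{p: d^t(c,p)\le r\}$ is the translation ball. A lattice $\Gamma$ is a discrete subgroup of $\mathbf{Sol}$ that is generated by three elements and acts by the translations $p\mapsto pg$ with a compact fundamental domain. For $t_1,t_2\neq 0$ and an integer $N\ge 3$ put $h=\log\frac{N+\sqrt{N^2-4}}2$; the fundamental lattice $\Gamma(t_1,t_2,N)$ is the subgroup generated by $\tau_1=(t_1,t_2,0)$, $\tau_2=(t_1e^{-h},t_2e^{h},0)$, $\tau_3=(0,0,h)$. The balls $B(g,r)$, $g\in\Gamma$, form a covering if their union is $\mathbf{Sol}$. Let $\Delta(\Gamma,r)=\mathrm{Vol}(B(O,r))/\mathrm{Vol}(\mathcal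 F_\Gamma)$, where $O=(0,0,0)$ and $\mathcal F_\Gamma$ is a fundamental domain of $\Gamma$, and let $R_\Gamma$ be the infimum of the $r>0$ for which the balls cover. The optimal covering density $\Delta_{\mathrm{opt}}$ of a family of lattices is the infimum of $\Delta(\Gamma,R_\Gamma)$ over the family. With $P=\tau_1$, $P'=\tau_2$, $Q=\tau_1\tau_2$, $P_3=\tau_3$ and $X^{\tau_3}=X\tau_3$, consider the six tetrahedra with vertices $$\{O,P_3,P^{\tau_3},P'^{\tau_3}\},\ \{O,P,P^{\tau_3},P'\},\ \{O,P',P^{\tau_3},P'^{\tau_3}\},\ \{Q^{\tau_3},P^{\tau_3},P',P\},\ \{Q^{\tau_3},Q,P',P\},\ \{Q^{\tau_3},P'^{\tau_3},P',P^{\tau_3}\}.$$ A circumscribed sphere of a tetrahedron is a translation sphere (the set of points at a fixed translation distance $r>0$ from a centre) through its four vertices; the circumradius is its radius (the infimum of the possible radii, should there be several). **Theorem.** For the lattice $\Gamma=\Gamma(0.79,\,0.2,\,3)$ each of the six tetrahedra has a circumscribed sphere. Let $R$ be the largest of their six circumradii. Then the balls of radius $R$ centred at the points of $\Gamma$ cover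 $\mathbf{Sol}$, and $$\Delta_{\mathrm{opt}}\le\Delta(\Gamma,R)\approx 6.47048,\qquad\text{that is, } |\Delta(\Gamma,R)-6.47048|<5\cdot10^{-6},$$ both when $\Delta_{\mathrm{opt}}$ is taken over all fundamental lattices and when it is taken over all lattices of $\mathbf{Sol}$. -/

import Mathlib

/-- The model of Sol geometry on `ℝ³`; a point is a triple of real coordinates `(x, y, z)`. -/
def Sol : Type := ℝ × ℝ × ℝ

namespace Sol

def x (p : Sol) : ℝ := p.1
def y (p : Sol) : ℝ := p.2.1
def z (p : Sol) : ℝ := p.2.2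

def mk (a b c : ℝ) : Sol := (a, b, c)

theorem ext' {p q : Sol} (hx : p.x = q.x) (hy : p.y = q.y) (hz : p.z = q.z) : p = q :=
  Prod.ext hx (Prod.ext hy hz)

/-- The topology of `ℝ³`. -/
instance : TopologicalSpace Sol := inferInstanceAs (TopologicalSpace (ℝ × ℝ × ℝ))
instance : MeasurableSpace Sol := inferInstanceAs (MeasurableSpace (ℝ × ℝ × ℝ))

/-- Lebesgue measure `dx dy dz`. It is the Riemannian volume of
`ds² = e^{2z} dx² + e^{-2z} dy² + dz²`, since the determinant of this metric is `1`. -/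
noncomputable instance : MeasureTheory.MeasureSpace Sol :=
  inferInstanceAs (MeasureTheory.MeasureSpace (ℝ × ℝ × ℝ))

/-- The group law `(a,b,c)(x,y,z) = (x + a e^{-z}, y + b e^z, z + c)`. The isometric
translations of the geometry are the maps `p ↦ p * g`. -/
noncomputable instance : Group Sol where
  mul p q := mk (q.x + p.x * Real.exp (-q.z)) (q.y + p.y * Real.exp q.z) (q.z + p.z)
  one := mk 0 0 0
  inv p := mk (-p.x * Real.exp p.z) (-p.y * Real.exp (-p.z)) (-p.z)
  mul_assoc p q r := by
    apply ext'
    · change r.x + (q.x + p.x * Real.exp (-q.z)) * Real.exp (-r.z)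
        = (r.x + q.x * Real.exp (-r.z)) + p.x * Real.exp (-(r.z + q.z))
      rw [neg_add, Real.exp_add]; ring
    · change r.y + (q.y + p.y * Real.exp q.z) * Real.exp r.z
        = (r.y + q.y * Real.exp r.z) + p.y * Real.exp (r.z + q.z)
      rw [Real.exp_add]; ring
    · change r.z + (q.z + p.z) = (r.z + q.z) + p.z
      ring
  one_mul p := by
    apply ext'
    · change p.x + 0 * Real.exp (-p.z) = p.x
      ring
    · change p.y + 0 * Real.exp p.z = p.y
      ring
    · change p.z + 0 = p.z
      ring
  mul_one p := by
    apply ext'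
    · change 0 + p.x * Real.exp (-0) = p.x
      simp
    · change 0 + p.y * Real.exp 0 = p.y
      simp
    · change 0 + p.z = p.z
      simp
  inv_mul_cancel p := by
    apply ext'
    · change p.x + (-p.x * Real.exp p.z) * Real.exp (-p.z) = 0
      rw [mul_assoc, ← Real.exp_add]; simp
    · change p.y + (-p.y * Real.exp (-p.z)) * Real.exp p.z = 0
      rw [mul_assoc, ← Real.exp_add]; simp
    · change p.z + -p.z = 0
      ring

/-- Translation curves: the velocity at every point `γ t` is the image of one fixed vector
`(u, v, w)` at the origin under the differential of the translation `p ↦ p * γ t`. -/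
def IsTranslationCurve (γ : ℝ → Sol) : Prop :=
  ∃ u v w : ℝ, ∀ t : ℝ,
    HasDerivAt (fun s => (γ s).x) (u * Real.exp (-(γ t).z)) t ∧
    HasDerivAt (fun s => (γ s).y) (v * Real.exp (γ t).z) t ∧
    HasDerivAt (fun s => (γ s).z) w t

/-- Length of `γ` between the parameters `0` and `1` for the metric
`ds² = e^{2z} dx² + e^{-2z} dy² + dz²`. -/
noncomputable def arcLength (γ : ℝ → Sol) : ℝ :=
  ∫ t in (0 : ℝ)..1, Real.sqrt
    (Real.exp (2 * (γ t).z) * (deriv (fun s => (γ s).x) t) ^ 2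
      + Real.exp (-2 * (γ t).z) * (deriv (fun s => (γ s).y) t) ^ 2
      + (deriv (fun s => (γ s).z) t) ^ 2)

/-- Translation distance: the arc length of the translation curve from `p` to `q`. (This curve,
parametrized by `[0, 1]`, is unique; `transDist_eq` evaluates its length.) -/
noncomputable def transDist (p q : Sol) : ℝ :=
  sInf {L : ℝ | ∃ γ : ℝ → Sol, IsTranslationCurve γ ∧ γ 0 = p ∧ γ 1 = q ∧ L = arcLength γ}

/-- The value of `∫₀¹ e^{s t} dt`. -/
noncomputable def expAvg (s : ℝ) : ℝ := if s = 0 then 1 else (Real.exp s - 1) / s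

theorem integral_exp_mul (s : ℝ) : ∫ t in (0 : ℝ)..1, Real.exp (s * t) = expAvg s := by
  unfold expAvg
  split_ifs with h
  · simp [h]
  · rw [intervalIntegral.integral_comp_mul_left (fun t => Real.exp t) h]
    simp [integral_exp]
    field_simp

theorem expAvg_pos (s : ℝ) : 0 < expAvg s := by
  rw [← integral_exp_mul]
  exact intervalIntegral.intervalIntegral_pos_of_pos
    ((by fun_prop : Continuous fun t : ℝ => Real.exp (s * t)).intervalIntegrable _ _)
    (fun t => Real.exp_pos _) one_pos

theorem hasDerivAt_expPrim (s t : ℝ) :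
    HasDerivAt (fun r => ∫ a in (0 : ℝ)..r, Real.exp (s * a)) (Real.exp (s * t)) t := by
  have hc : Continuous fun a : ℝ => Real.exp (s * a) := by fun_prop
  exact intervalIntegral.integral_hasDerivAt_right (hc.intervalIntegrable _ _)
    (hc.stronglyMeasurableAtFilter _ _) hc.continuousAt

theorem arcLength_of_velocity {γ : ℝ → Sol} {u v w : ℝ}
    (h : ∀ t : ℝ, HasDerivAt (fun s => (γ s).x) (u * Real.exp (-(γ t).z)) t ∧
      HasDerivAt (fun s => (γ s).y) (v * Real.exp (γ t).z) t ∧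
      HasDerivAt (fun s => (γ s).z) w t) :
    arcLength γ = Real.sqrt (u ^ 2 + v ^ 2 + w ^ 2) := by
  unfold arcLength
  have : ∀ t : ℝ, Real.sqrt
    (Real.exp (2 * (γ t).z) * (deriv (fun s => (γ s).x) t) ^ 2
      + Real.exp (-2 * (γ t).z) * (deriv (fun s => (γ s).y) t) ^ 2
      + (deriv (fun s => (γ s).z) t) ^ 2) = Real.sqrt (u ^ 2 + v ^ 2 + w ^ 2) := by
    intro t
    rw [(h t).1.deriv, (h t).2.1.deriv, (h t).2.2.deriv]
    congr 1
    have h1 : Real.exp (2 * (γ t).z) * Real.exp (-(γ t).z) ^ 2 = 1 := by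
      rw [← Real.exp_nat_mul, ← Real.exp_add]; simp
    have h2 : Real.exp (-2 * (γ t).z) * Real.exp (γ t).z ^ 2 = 1 := by
      rw [← Real.exp_nat_mul, ← Real.exp_add]; simp
    linear_combination u ^ 2 * h1 + v ^ 2 * h2
  simp_rw [this]
  simp

/-- Closed form of the translation distance. -/
theorem transDist_eq (p q : Sol) :
    transDist p q = Real.sqrt
      (((q.x - p.x) * Real.exp p.z / expAvg (-(q.z - p.z))) ^ 2
        + ((q.y - p.y) * Real.exp (-p.z) / expAvg (q.z - p.z)) ^ 2 + (q.z - p.z) ^ 2) := by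
  set w := q.z - p.z with hw
  set u := (q.x - p.x) * Real.exp p.z / expAvg (-w) with hu
  set v := (q.y - p.y) * Real.exp (-p.z) / expAvg w with hv
  have e1 := (expAvg_pos (-w)).ne'
  have e2 := (expAvg_pos w).ne'
  have e3 : Real.exp p.z * Real.exp (-p.z) = 1 := by rw [← Real.exp_add]; simp
  have key : {L : ℝ | ∃ γ : ℝ → Sol, IsTranslationCurve γ ∧ γ 0 = p ∧ γ 1 = q ∧
      L = arcLength γ} = {Real.sqrt (u ^ 2 + v ^ 2 + w ^ 2)} := by
    ext L
    simp only [Set.mem_ofPred_eq, Set.mem_singleton_iff]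
    constructor
    · rintro ⟨γ, ⟨u', v', w', h⟩, h0, h1, rfl⟩
      rw [arcLength_of_velocity h]
      have hz : ∀ t, (γ t).z = p.z + w' * t := by
        intro t
        have hc : ∀ s, HasDerivAt (fun s => (γ s).z - w' * s) 0 s := fun s =>
          ((h s).2.2.sub ((hasDerivAt_id s).const_mul w')).congr_deriv (by simp)
        have := is_const_of_deriv_eq_zero (fun s => (hc s).differentiableAt)
          (fun s => (hc s).deriv) t 0
        simp only [h0, mul_zero, sub_zero] at this
        linarith
      have hw' : w' = w := by
        have := hz 1
        rw [h1] at this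
        rw [hw]; linarith
      subst hw'
      have hx : q.x - p.x = u' * Real.exp (-p.z) * expAvg (-w) := by
        have := intervalIntegral.integral_eq_sub_of_hasDerivAt
          (f := fun s => (γ s).x) (f' := fun t => u' * Real.exp (-p.z) * Real.exp (-w * t))
          (a := 0) (b := 1)
          (fun t _ => by
            have := (h t).1
            rwa [hz t, neg_add, Real.exp_add, ← mul_assoc, ← neg_mul] at this)
          ((by fun_prop : Continuous fun t : ℝ =>
            u' * Real.exp (-p.z) * Real.exp (-w * t)).intervalIntegrable _ _)
        rw [intervalIntegral.integral_const_mul, integral_exp_mul, h0, h1] at this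
        exact this.symm
      have hy : q.y - p.y = v' * Real.exp p.z * expAvg w := by
        have := intervalIntegral.integral_eq_sub_of_hasDerivAt
          (f := fun s => (γ s).y) (f' := fun t => v' * Real.exp p.z * Real.exp (w * t))
          (a := 0) (b := 1)
          (fun t _ => by
            have := (h t).2.1
            rwa [hz t, Real.exp_add, ← mul_assoc] at this)
          ((by fun_prop : Continuous fun t : ℝ =>
            v' * Real.exp p.z * Real.exp (w * t)).intervalIntegrable _ _)
        rw [intervalIntegral.integral_const_mul, integral_exp_mul, h0, h1] at this
        exact this.symm
      have hu' : u' = u := by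
        rw [hu, hx, eq_div_iff e1]
        linear_combination (-u' * expAvg (-w)) * e3
      have hv' : v' = v := by
        rw [hv, hy, eq_div_iff e2]
        linear_combination (-v' * expAvg w) * e3
      rw [hu', hv']
    · rintro rfl
      have hcurve : ∀ t : ℝ,
          HasDerivAt (fun s => p.x + u * Real.exp (-p.z) * ∫ a in (0 : ℝ)..s, Real.exp (-w * a))
            (u * Real.exp (-(p.z + w * t))) t ∧
          HasDerivAt (fun s => p.y + v * Real.exp p.z * ∫ a in (0 : ℝ)..s, Real.exp (w * a))
            (v * Real.exp (p.z + w * t)) t ∧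
          HasDerivAt (fun s => p.z + w * s) w t := by
        intro t
        refine ⟨?_, ?_, ?_⟩
        · rw [neg_add, Real.exp_add, ← mul_assoc, ← neg_mul]
          exact ((hasDerivAt_expPrim (-w) t).const_mul _).const_add _
        · rw [Real.exp_add, ← mul_assoc]
          exact ((hasDerivAt_expPrim w t).const_mul _).const_add _
        · simpa using ((hasDerivAt_id t).const_mul w).const_add p.z
      refine ⟨fun t => mk (p.x + u * Real.exp (-p.z) * ∫ a in (0 : ℝ)..t, Real.exp (-w * a))
        (p.y + v * Real.exp p.z * ∫ a in (0 : ℝ)..t, Real.exp (w * a)) (p.z + w * t),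
        ⟨u, v, w, hcurve⟩, ?_, ?_, ?_⟩
      · apply ext' <;> simp [mk, x, y, z]
      · apply ext'
        · change p.x + u * Real.exp (-p.z) * ∫ a in (0 : ℝ)..1, Real.exp (-w * a) = q.x
          rw [integral_exp_mul, hu]
          field_simp
          linear_combination (q.x - p.x) * e3
        · change p.y + v * Real.exp p.z * ∫ a in (0 : ℝ)..1, Real.exp (w * a) = q.y
          rw [integral_exp_mul, hv]
          field_simp
          linear_combination (q.y - p.y) * e3
        · change p.z + w * 1 = q.z
          rw [hw]; ring
      · exact (arcLength_of_velocity (u := u) (v := v) (w := w) (γ := fun t => mk _ _ _)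
          hcurve).symm
  unfold transDist
  rw [key, csInf_singleton]

/-- The translation ball of centre `c` and radius `r`. -/
def transBall (c : Sol) (r : ℝ) : Set Sol := {p | transDist c p ≤ r}

/-- A lattice: a discrete group of translations, generated by three translations, with a compact
fundamental domain. -/
def IsLattice (Γ : Subgroup Sol) : Prop :=
  (∃ τ₁ τ₂ τ₃ : Sol, Γ = Subgroup.closure {τ₁, τ₂, τ₃}) ∧
  DiscreteTopology Γ ∧
  ∃ K : Set Sol, IsCompact K ∧ ∀ p : Sol, ∃ g ∈ Γ, p * g ∈ K

/-- The balls of radius `r` centred at the points of the point lattice of `Γ` (the orbit of the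
origin) cover the space. -/
def Covers (Γ : Subgroup Sol) (r : ℝ) : Prop :=
  (⋃ g ∈ Γ, transBall g r) = Set.univ

/-- The density of the arrangement of balls of radius `r` centred at the points of `Γ`: the volume
of a ball divided by the volume of a fundamental domain of the action of `Γ` by translations
`p ↦ p * g`. -/
noncomputable def density (Γ : Subgroup Sol) (r : ℝ) : ℝ :=
  (MeasureTheory.volume (transBall 1 r)).toReal /
    (MeasureTheory.covolume Γ.op Sol MeasureTheory.volume).toReal

/-- The minimal covering radius of `Γ`. -/
noncomputable def minCoveringRadius (Γ : Subgroup Sol) : ℝ :=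
  sInf {r : ℝ | 0 < r ∧ Covers Γ r}

/-- The optimal (least) density of lattice-like coverings by congruent translation balls over a
family of lattices. -/
noncomputable def optimalCoveringDensity (family : Set (Subgroup Sol)) : ℝ :=
  sInf ((fun Γ => density Γ (minCoveringRadius Γ)) '' family)

/-- The third coordinate of the third generator of a fundamental lattice. -/
noncomputable def height (N : ℕ) : ℝ := Real.log ((N + Real.sqrt ((N : ℝ) ^ 2 - 4)) / 2)

/-- The generators of the fundamental lattice with parameters `t₁ = t₁¹`, `t₂ = t₁²` and `N`. -/
noncomputable def tau₁ (t₁ t₂ : ℝ) : Sol := mk t₁ t₂ 0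
noncomputable def tau₂ (t₁ t₂ : ℝ) (N : ℕ) : Sol :=
  mk (t₁ * Real.exp (-height N)) (t₂ * Real.exp (height N)) 0
noncomputable def tau₃ (N : ℕ) : Sol := mk 0 0 (height N)

/-- `Γ(t₁, t₂, N)`. -/
noncomputable def fundLattice (t₁ t₂ : ℝ) (N : ℕ) : Subgroup Sol :=
  Subgroup.closure {tau₁ t₁ t₂, tau₂ t₁ t₂ N, tau₃ N}

/-- `Γ` is a fundamental lattice; `t₁ t₂ ≠ 0` says that `tau₁` and `tau₂` are linearly
independent. -/
def IsFundamentalLattice (Γ : Subgroup Sol) : Prop :=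
  ∃ (t₁ t₂ : ℝ) (N : ℕ), t₁ ≠ 0 ∧ t₂ ≠ 0 ∧ 3 ≤ N ∧ Γ = fundLattice t₁ t₂ N

/-- The vertices of the six tetrahedra with vertices among those of the fundamental parallelepiped
`O P P' Q P₃ P^{τ₃} P'^{τ₃} Q^{τ₃}`, where `P = τ₁`, `P' = τ₂`, `Q = τ₁ τ₂`, `P₃ = τ₃` and
`X^{τ₃} = X * τ₃`. -/
noncomputable def tetrahedron (t₁ t₂ : ℝ) (N : ℕ) : Fin 6 → Fin 4 → Sol :=
  let O : Sol := 1
  let P := tau₁ t₁ t₂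
  let P' := tau₂ t₁ t₂ N
  let Q := P * P'
  let P₃ := tau₃ N
  let Pτ := P * tau₃ N
  let P'τ := P' * tau₃ N
  let Qτ := Q * tau₃ N
  ![![O, P₃, Pτ, P'τ], ![O, P, Pτ, P'], ![O, P', Pτ, P'τ],
    ![Qτ, Pτ, P', P], ![Qτ, Q, P', P], ![Qτ, P'τ, P', Pτ]]

/-- The translation sphere of centre `c` and radius `r` is circumscribed about `A`. -/
def IsCircumsphere (A : Fin 4 → Sol) (c : Sol) (r : ℝ) : Prop :=
  0 < r ∧ ∀ i, transDist c (A i) = r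

/-- The circumradius of a tetrahedron with vertices `A`: the radius of its circumscribed sphere
(the infimum only serves to select it; it is meaningful when such a sphere exists). -/
noncomputable def circumradius (A : Fin 4 → Sol) : ℝ :=
  sInf {r : ℝ | ∃ c, IsCircumsphere A c r}

/-- The largest circumradius of the six tetrahedra. -/
noncomputable def maxCircumradius (t₁ t₂ : ℝ) (N : ℕ) : ℝ :=
  Finset.univ.sup' Finset.univ_nonempty fun i : Fin 6 => circumradius (tetrahedron t₁ t₂ N i)

end Sol

/-! Write E = e^h = (3 + √5)/2, so that E² = 3E - 1. The reciprocal `bern` of `expAvg` turns the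
squared translation distance from (X, Y, z) to a point at height 0 or h into `sqDistFloor` or
`sqDistCeil`. For fixed z these are quadratic in X and Y, and points at the same height share their
quadratic part. Every tetrahedron has all its vertices at these two heights, so equidistance within
each height is a pair of linear equations. Their solution is a curve, the `axis`, parametrized by z.
On it only one equation in z remains, floor distance equal to ceiling distance, and
`exists_circumsphere` solves it by the intermediate value theorem.

Five tetrahedra have a circumsphere with r² ≤ 0.645. For the remaining one, index 4, the root is
bracketed within 10⁻⁸, which gives r² ≤ 0.6463087201. Since a circumradius is an infimum, a bound
below is needed for all its circumspheres: each centre lies on the axis (`axis_of_equidistant`), and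
on either side of the bracket's left end one of the two distances is at least its value there
(`le_axisFloor_of_le`, `le_axisCeil_of_le`). Hence R is known to about 10⁻⁸.

The covering property does not pass through the tetrahedra. A right translation by a lattice point
brings any point to |z| ≤ h/2, and rounding in a reduced horizontal basis finds a lattice point at
squared distance at most 0.63 < R² (`exists_floor_point_near`).

For the density, the points of Γ are those with integer coordinates in the basis `tau₁`, `tau₂`,
`tau₃`, because multiplication by E preserves ℤ + ℤE; the half-open parallelepiped then gives the
covolume |t₁t₂|√5·h. The horizontal slices of the ball are ellipses of area π(R² - c²)(2 cosh c -
2)/c², integrated by a Taylor polynomial with explicit error. The bounds on the optimal densities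
follow because the ball volume is monotone in the radius and densities are nonnegative. -/

namespace Sol

/-! ### The Bernoulli function and squared translation distances -/

/-- The generating function `s / (e^s - 1)` of the Bernoulli numbers, with value `1` at `0`. -/
noncomputable def bern (s : ℝ) : ℝ := (expAvg s)⁻¹

theorem bern_pos (s : ℝ) : 0 < bern s := inv_pos.2 (expAvg_pos s)

theorem bern_of_ne {s : ℝ} (hs : s ≠ 0) : bern s = s / (Real.exp s - 1) := by
  rw [bern, expAvg, if_neg hs, inv_div]

theorem exp_mul_bern (s : ℝ) : Real.exp s * bern s = bern (-s) := by
  have h : expAvg (-s) * Real.exp s = expAvg s := by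
    unfold expAvg
    by_cases hs : s = 0
    · simp [hs]
    · rw [if_neg (neg_ne_zero.2 hs), if_neg hs, Real.exp_neg]
      have := (Real.exp_pos s).ne'
      field_simp
      ring
  have h1 := (expAvg_pos s).ne'
  have h2 := (expAvg_pos (-s)).ne'
  unfold bern
  field_simp
  linear_combination h

/-- Together with `bern_antitone` this says that `bern` decreases, but with slope at least -1, since
s ↦ `bern (-s)` increases. All monotonicity arguments along the axis rest on these two facts. -/
theorem bern_neg (s : ℝ) : bern (-s) = bern s + s := by
  rw [← exp_mul_bern]
  by_cases hs : s = 0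
  · simp [hs]
  · rw [bern_of_ne hs]
    have : Real.exp s - 1 ≠ 0 := sub_ne_zero.2 (by simpa using hs)
    field_simp
    ring

theorem expAvg_mono : Monotone expAvg := by
  intro s t hst
  rw [← integral_exp_mul, ← integral_exp_mul]
  apply intervalIntegral.integral_mono_on zero_le_one
  · exact (by fun_prop : Continuous fun a : ℝ => Real.exp (s * a)).intervalIntegrable _ _
  · exact (by fun_prop : Continuous fun a : ℝ => Real.exp (t * a)).intervalIntegrable _ _
  · intro a ha
    exact Real.exp_le_exp.2 (mul_le_mul_of_nonneg_right hst ha.1)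

theorem bern_antitone : Antitone bern := fun s _ hst =>
  inv_anti₀ (expAvg_pos s) (expAvg_mono hst)

theorem bern_neg_mono {s t : ℝ} (h : s ≤ t) : bern (-s) ≤ bern (-t) :=
  bern_antitone (neg_le_neg h)

theorem continuousOn_bern : ContinuousOn bern (Set.Ioi 0) := by
  have : ContinuousOn (fun s : ℝ => s / (Real.exp s - 1)) (Set.Ioi 0) := by
    apply ContinuousOn.div (by fun_prop) (by fun_prop)
    intro s hs
    exact sub_ne_zero.2 (by simpa using (ne_of_gt hs))
  exact this.congr fun s hs => bern_of_ne (ne_of_gt hs)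

/-- `C * bern w ^ 2 + w ^ 2` stays above its value at `a` as long as `C` is moderate. -/
theorem bern_sq_add_sq_le {C a w : ℝ} (hC : 0 ≤ C) (hCa : C * bern a ≤ a) (haw : a ≤ w) :
    C * bern a ^ 2 + a ^ 2 ≤ C * bern w ^ 2 + w ^ 2 := by
  have h1 := bern_antitone haw
  have h2 := bern_neg_mono haw
  rw [bern_neg, bern_neg] at h2
  have h3 := bern_pos w
  have h4 := bern_pos a
  -- The loss in `bern ^ 2` is at most 2 `bern a` (w - a) by the slope bound; `hCa` turns C times
  -- this into 2a(w - a), which is at most the gain w² - a².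
  have h5 : C * (bern a ^ 2 - bern w ^ 2) ≤ C * (2 * bern a * (w - a)) := by
    apply mul_le_mul_of_nonneg_left _ hC
    nlinarith
  have h6 : C * bern a * (w - a) ≤ a * (w - a) :=
    mul_le_mul_of_nonneg_right hCa (sub_nonneg.2 haw)
  nlinarith [sq_nonneg (w - a)]

theorem transDist_nonneg (p q : Sol) : 0 ≤ transDist p q := by
  rw [transDist_eq]; exact Real.sqrt_nonneg _

theorem transDist_sq (p q : Sol) : transDist p q ^ 2 =
    ((q.x - p.x) * Real.exp p.z * bern (p.z - q.z)) ^ 2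
      + ((q.y - p.y) * Real.exp (-p.z) * bern (q.z - p.z)) ^ 2 + (q.z - p.z) ^ 2 := by
  rw [transDist_eq, Real.sq_sqrt (by positivity), neg_sub]
  simp only [bern, div_eq_mul_inv]

/-- Squared distance from `(X, Y, z)` to a point at height `0`. -/
noncomputable def sqDistFloor (X Y z a b : ℝ) : ℝ :=
  (bern (-z) * (a - X)) ^ 2 + (bern z * (b - Y)) ^ 2 + z ^ 2

/-- Squared distance from `(X, Y, h - w)` to a point at height `h`, where `E = e^h`. -/
noncomputable def sqDistCeil (E X Y w a b : ℝ) : ℝ :=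
  (E * bern w * (a - X)) ^ 2 + (E⁻¹ * bern (-w) * (b - Y)) ^ 2 + w ^ 2

theorem transDist_floor_sq (X Y z a b : ℝ) :
    transDist (mk X Y z) (mk a b 0) ^ 2 = sqDistFloor X Y z a b := by
  rw [transDist_sq, sqDistFloor]
  change ((a - X) * Real.exp z * bern (z - 0)) ^ 2
      + ((b - Y) * Real.exp (-z) * bern (0 - z)) ^ 2 + (0 - z) ^ 2 = _
  rw [sub_zero, zero_sub, mul_assoc (a - X), exp_mul_bern, mul_assoc (b - Y), exp_mul_bern,
    neg_neg]
  ring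

theorem transDist_ceil_sq (X Y z a b h : ℝ) :
    transDist (mk X Y z) (mk a b h) ^ 2 = sqDistCeil (Real.exp h) X Y (h - z) a b := by
  rw [transDist_sq, sqDistCeil]
  change ((a - X) * Real.exp z * bern (z - h)) ^ 2
      + ((b - Y) * Real.exp (-z) * bern (h - z)) ^ 2 + (h - z) ^ 2 = _
  have e1 : Real.exp z * bern (z - h) = Real.exp h * bern (h - z) := by
    rw [show z - h = -(h - z) by ring, ← exp_mul_bern, ← mul_assoc, ← Real.exp_add]
    congr 2; ring
  have e2 : Real.exp (-z) * bern (h - z) = (Real.exp h)⁻¹ * bern (-(h - z)) := by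
    rw [← exp_mul_bern, ← mul_assoc, ← Real.exp_neg, ← Real.exp_add]
    congr 2; ring
  rw [mul_assoc (a - X), mul_assoc (b - Y), e1, e2]
  ring

/-! ### Numerical enclosures -/

theorem bern_lower {a hi c : ℝ} (ha : 0 < a) (hexp : Real.exp a ≤ hi)
    (hc : c * (hi - 1) ≤ a) (hc0 : 0 ≤ c) : c ≤ bern a := by
  have h1 : 0 < Real.exp a - 1 := by simpa using ha
  rw [bern_of_ne ha.ne', le_div_iff₀ h1]
  exact (mul_le_mul_of_nonneg_left (by linarith) hc0).trans hc

theorem bern_upper {a lo c : ℝ} (ha : 0 < a) (hexp : lo ≤ Real.exp a)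
    (hc : a ≤ c * (lo - 1)) (hc0 : 0 ≤ c) : bern a ≤ c := by
  have h1 : 0 < Real.exp a - 1 := by simpa using ha
  rw [bern_of_ne ha.ne', div_le_iff₀ h1]
  exact hc.trans (mul_le_mul_of_nonneg_left (by linarith) hc0)

theorem le_exp_of_taylor {x c : ℝ} (hx : 0 ≤ x) (n : ℕ)
    (h : c ≤ ∑ i ∈ Finset.range n, x ^ i / i.factorial) : c ≤ Real.exp x :=
  h.trans (Real.sum_le_exp_of_nonneg hx n)

theorem exp_le_of_taylor {x c : ℝ} (h0 : 0 ≤ x) (h1 : x ≤ 1) (n : ℕ) (hn : 0 < n)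
    (h : ∑ i ∈ Finset.range n, x ^ i / i.factorial + x ^ n * (n + 1) / (n.factorial * n) ≤ c) :
    Real.exp x ≤ c :=
  (Real.exp_bound' h0 h1 hn).trans h

/-- `e^h` for `N = 3`, the square of the golden ratio. -/
noncomputable def unit3 : ℝ := (3 + Real.sqrt 5) / 2

theorem sqrt_five_bounds :
    2.236067977499789 < Real.sqrt 5 ∧ Real.sqrt 5 < 2.23606797749979 := by
  constructor
  · exact Real.lt_sqrt_of_sq_lt (by norm_num)
  · rw [Real.sqrt_lt' (by norm_num)]; norm_num

theorem unit3_bounds : 2.618033988749894 < unit3 ∧ unit3 < 2.618033988749895 := by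
  have := sqrt_five_bounds
  unfold unit3
  constructor <;> linarith [this.1, this.2]

theorem unit3_pos : 0 < unit3 := by linarith [unit3_bounds.1]

theorem unit3_sq : unit3 ^ 2 = 3 * unit3 - 1 := by
  have : Real.sqrt 5 ^ 2 = 5 := Real.sq_sqrt (by norm_num)
  unfold unit3
  linear_combination this / 4

/-- The inverse of E is its Galois conjugate, so lattice coordinates and their rescalings by powers
of E stay linear in E. -/
theorem unit3_inv : unit3⁻¹ = 3 - unit3 :=
  inv_eq_of_mul_eq_one_right (by linear_combination -unit3_sq)

theorem height_three : height 3 = Real.log unit3 := by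
  unfold height unit3
  norm_num

theorem exp_height_three : Real.exp (height 3) = unit3 := by
  rw [height_three, Real.exp_log unit3_pos]

theorem exp_neg_height_three : Real.exp (-height 3) = 3 - unit3 := by
  rw [Real.exp_neg, exp_height_three, unit3_inv]

theorem height_three_bounds :
    0.9624236501192 < height 3 ∧ height 3 < 0.9624236501193 := by
  rw [height_three]
  constructor
  · rw [Real.lt_log_iff_exp_lt unit3_pos]
    refine lt_of_le_of_lt (exp_le_of_taylor (c := 2.6180339887498780) (by norm_num) (by norm_num)
      18 (by norm_num) ?_) (by linarith [unit3_bounds.1])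
    norm_num [Finset.sum_range_succ, Nat.factorial]
  · rw [Real.log_lt_iff_lt_exp unit3_pos]
    refine lt_of_lt_of_le (b := 2.6180339887500) (by linarith [unit3_bounds.2])
      (le_exp_of_taylor (by norm_num) 18 ?_)
    norm_num [Finset.sum_range_succ, Nat.factorial]

theorem exp_bounds_030 : 1.349858 ≤ Real.exp 0.3 ∧ Real.exp 0.3 ≤ 1.349859 :=
  ⟨le_exp_of_taylor (by norm_num) 10 (by norm_num [Finset.sum_range_succ, Nat.factorial]),
   exp_le_of_taylor (by norm_num) (by norm_num) 10 (by norm_num)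
    (by norm_num [Finset.sum_range_succ, Nat.factorial])⟩

theorem exp_bounds_045 : 1.568312 ≤ Real.exp 0.45 ∧ Real.exp 0.45 ≤ 1.568313 :=
  ⟨le_exp_of_taylor (by norm_num) 10 (by norm_num [Finset.sum_range_succ, Nat.factorial]),
   exp_le_of_taylor (by norm_num) (by norm_num) 10 (by norm_num)
    (by norm_num [Finset.sum_range_succ, Nat.factorial])⟩

theorem exp_bounds_054 : 1.716006 ≤ Real.exp 0.54 ∧ Real.exp 0.54 ≤ 1.716007 :=
  ⟨le_exp_of_taylor (by norm_num) 10 (by norm_num [Finset.sum_range_succ, Nat.factorial]),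
   exp_le_of_taylor (by norm_num) (by norm_num) 10 (by norm_num)
    (by norm_num [Finset.sum_range_succ, Nat.factorial])⟩

theorem exp_bounds_064 : 1.896480 ≤ Real.exp 0.64 ∧ Real.exp 0.64 ≤ 1.896481 :=
  ⟨le_exp_of_taylor (by norm_num) 10 (by norm_num [Finset.sum_range_succ, Nat.factorial]),
   exp_le_of_taylor (by norm_num) (by norm_num) 10 (by norm_num)
    (by norm_num [Finset.sum_range_succ, Nat.factorial])⟩

theorem exp_bounds_056271755 :
    1.7554365106355 ≤ Real.exp 0.56271755 ∧ Real.exp 0.56271755 ≤ 1.7554365106356 :=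
  ⟨le_exp_of_taylor (by norm_num) 16 (by norm_num [Finset.sum_range_succ, Nat.factorial]),
   exp_le_of_taylor (by norm_num) (by norm_num) 16 (by norm_num)
    (by norm_num [Finset.sum_range_succ, Nat.factorial])⟩

theorem exp_bounds_056271756 :
    1.7554365281899 ≤ Real.exp 0.56271756 ∧ Real.exp 0.56271756 ≤ 1.7554365281900 :=
  ⟨le_exp_of_taylor (by norm_num) 16 (by norm_num [Finset.sum_range_succ, Nat.factorial]),
   exp_le_of_taylor (by norm_num) (by norm_num) 16 (by norm_num)
    (by norm_num [Finset.sum_range_succ, Nat.factorial])⟩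

/-- Numerical enclosures, valid at `z`, of the transcendental quantities in the distances from a
point at height `z`. -/
structure Enclosure (z ul uu vl vu gl gu wl wu : ℝ) : Prop where
  ul : ul ≤ Real.exp (2 * z)
  uu : Real.exp (2 * z) ≤ uu
  vl : vl ≤ Real.exp (-(2 * z))
  vu : Real.exp (-(2 * z)) ≤ vu
  gl : gl ≤ bern z
  gu : bern z ≤ gu
  wl : wl ≤ bern (height 3 - z)
  wu : bern (height 3 - z) ≤ wu

/-- Each of the four quantities is monotone in z, so rational bounds l ≤ e^a and e^b ≤ u at the ends
of [a, b] control them on the whole interval. The hypotheses are cleared of denominators, so that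
only rational arithmetic is left; the long decimals are the bounds for E and h. -/
theorem Enclosure.of_mem {a b z l u : ℝ} (ha : 0 < a) (hb : b < 0.96) (haz : a ≤ z) (hzb : z ≤ b)
    (hl0 : 0 < l) (hl : l ≤ Real.exp a) (hu : Real.exp b ≤ u)
    {ul uu vl vu gl gu wl wu : ℝ}
    (hul : ul ≤ l ^ 2) (huu : u ^ 2 ≤ uu) (hvl : vl * u ^ 2 ≤ 1) (hvu : 1 ≤ vu * l ^ 2)
    (hvl0 : 0 ≤ vl) (hvu0 : 0 ≤ vu)
    (hgl : gl * (u - 1) ≤ b) (hgu : a ≤ gu * (l - 1)) (hgl0 : 0 ≤ gl) (hgu0 : 0 ≤ gu)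
    (hwl : wl * (2.618033988749895 - l) ≤ (0.9624236501192 - a) * l) (hwl0 : 0 ≤ wl)
    (hwu : (0.9624236501193 - b) * u ≤ wu * (2.618033988749894 - u)) (hwu0 : 0 ≤ wu) :
    Enclosure z ul uu vl vu gl gu wl wu := by
  have hE := unit3_bounds
  have hh := height_three_bounds
  have hz0 : 0 < z := ha.trans_le haz
  have h1 : l ≤ Real.exp z := hl.trans (Real.exp_le_exp.2 haz)
  have h2 : Real.exp z ≤ u := (Real.exp_le_exp.2 hzb).trans hu
  have hU : Real.exp (2 * z) = Real.exp z ^ 2 := by rw [← Real.exp_nat_mul]; norm_num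
  have h3 : l ^ 2 ≤ Real.exp (2 * z) := hU ▸ pow_le_pow_left₀ hl0.le h1 2
  have h4 : Real.exp (2 * z) ≤ u ^ 2 := hU ▸ pow_le_pow_left₀ (Real.exp_pos z).le h2 2
  have hV : Real.exp (-(2 * z)) * Real.exp (2 * z) = 1 := by rw [← Real.exp_add]; simp
  have hVp := Real.exp_pos (-(2 * z))
  have hU0 := Real.exp_pos (2 * z)
  have hw : ∀ t, Real.exp (height 3 - t) = unit3 / Real.exp t := fun t => by
    rw [Real.exp_sub, exp_height_three]
  have hea := Real.exp_pos a
  have heb := Real.exp_pos b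
  refine ⟨hul.trans h3, h4.trans huu, ?_, ?_, ?_, ?_, ?_, ?_⟩
  · by_contra! hc
    nlinarith [mul_le_mul_of_nonneg_left h4 hvl0]
  · by_contra! hc
    nlinarith [mul_le_mul_of_nonneg_left h3 hvu0]
  · exact (bern_lower (hz0.trans_le hzb) hu hgl hgl0).trans (bern_antitone hzb)
  · exact (bern_antitone haz).trans (bern_upper ha hl hgu hgu0)
  · refine (bern_lower (a := height 3 - a) (by linarith) (hw a).le ?_ hwl0).trans
      (bern_antitone (by linarith))
    rw [div_sub_one hea.ne', mul_div_assoc', div_le_iff₀ hea]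
    have a1 : wl * (unit3 - Real.exp a) ≤ wl * (2.618033988749895 - l) :=
      mul_le_mul_of_nonneg_left (by linarith [hE.2]) hwl0
    have a2 : (0.9624236501192 - a) * l ≤ (height 3 - a) * Real.exp a :=
      mul_le_mul (by linarith [hh.1]) hl hl0.le (by linarith)
    linarith
  · refine (bern_antitone (by linarith)).trans
      (bern_upper (a := height 3 - b) (by linarith) (hw b).ge ?_ hwu0)
    rw [div_sub_one heb.ne', mul_div_assoc', le_div_iff₀ heb]
    have a1 : wu * (2.618033988749894 - u) ≤ wu * (unit3 - Real.exp b) :=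
      mul_le_mul_of_nonneg_left (by linarith [hE.1]) hwu0
    have a2 : (height 3 - b) * Real.exp b ≤ (0.9624236501193 - b) * u :=
      mul_le_mul (by linarith [hh.2]) hu heb.le (by linarith)
    linarith

/-! ### The axis of a tetrahedron and existence of circumspheres -/

/-- With U = e^{2z}, comparing two points at height 0 amounts to comparing U(a - X)² + (b - Y)²,
where the quadratic terms in X and Y cancel. Solving the linear equations gives X affine in e^{-2z}
and Y affine in e^{2z}. At height h only U is replaced by E²U. -/
theorem sqDistFloor_eq (X Y z a b : ℝ) : sqDistFloor X Y z a b =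
    bern z ^ 2 * (Real.exp (2 * z) * (a - X) ^ 2 + (b - Y) ^ 2) + z ^ 2 := by
  have : Real.exp (2 * z) = Real.exp z ^ 2 := by rw [← Real.exp_nat_mul]; norm_num
  rw [sqDistFloor, ← exp_mul_bern, this]
  ring

theorem sqDistCeil_eq (X Y z a b : ℝ) : sqDistCeil unit3 X Y (height 3 - z) a b =
    bern (height 3 - z) ^ 2 * Real.exp (-(2 * z)) *
      (unit3 ^ 2 * Real.exp (2 * z) * (a - X) ^ 2 + (b - Y) ^ 2) + (height 3 - z) ^ 2 := by
  have h1 : Real.exp (-(2 * z)) * Real.exp (2 * z) = 1 := by rw [← Real.exp_add]; simp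
  have h2 : Real.exp (-(2 * z)) = Real.exp (-z) ^ 2 := by rw [← Real.exp_nat_mul]; norm_num
  have h3 : unit3⁻¹ * bern (-(height 3 - z)) = Real.exp (-z) * bern (height 3 - z) := by
    rw [← exp_mul_bern, Real.exp_sub, exp_height_three, Real.exp_neg]
    field_simp [unit3_pos.ne']
  rw [sqDistCeil, h3]
  rw [h2] at h1 ⊢
  linear_combination (-bern (height 3 - z) ^ 2 * unit3 ^ 2 * (a - X) ^ 2) * h1

/-- For suitable coefficients, the curve of points equidistant from the vertices of a tetrahedron
at height `0` and equidistant from its vertices at height `height 3`. -/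
noncomputable def axis (α β γ δ z : ℝ) : Sol :=
  mk (α + β * Real.exp (-(2 * z))) (γ + δ * Real.exp (2 * z)) z

/-- Squared distance from the point of the axis at height `z` to `(a, b, 0)`. -/
noncomputable def axisFloor (α β γ δ a b z : ℝ) : ℝ :=
  sqDistFloor (α + β * Real.exp (-(2 * z))) (γ + δ * Real.exp (2 * z)) z a b

/-- Squared distance from the point of the axis at height `z` to `(a, b, height 3)`. -/
noncomputable def axisCeil (α β γ δ a b z : ℝ) : ℝ :=
  sqDistCeil unit3 (α + β * Real.exp (-(2 * z))) (γ + δ * Real.exp (2 * z)) (height 3 - z) a b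

theorem transDist_axis_floor (α β γ δ a b z : ℝ) :
    transDist (axis α β γ δ z) (mk a b 0) ^ 2 = axisFloor α β γ δ a b z :=
  transDist_floor_sq _ _ _ _ _

theorem transDist_axis_ceil (α β γ δ a b z : ℝ) :
    transDist (axis α β γ δ z) (mk a b (height 3)) ^ 2 = axisCeil α β γ δ a b z := by
  rw [axis, transDist_ceil_sq, exp_height_three, axisCeil]

/-- Equidistance along the whole axis becomes a polynomial identity in U = e^{2z} and V = e^{-2z}
modulo UV = 1. -/
theorem axisFloor_congr {α β γ δ a b a' b' : ℝ}
    (h : ∀ U V : ℝ, U * V = 1 → U * (a - (α + β * V)) ^ 2 + (b - (γ + δ * U)) ^ 2 =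
      U * (a' - (α + β * V)) ^ 2 + (b' - (γ + δ * U)) ^ 2) (z : ℝ) :
    axisFloor α β γ δ a b z = axisFloor α β γ δ a' b' z := by
  rw [axisFloor, axisFloor, sqDistFloor_eq, sqDistFloor_eq, h _ _ (by rw [← Real.exp_add]; simp)]

theorem axisCeil_congr {α β γ δ a b a' b' : ℝ}
    (h : ∀ U V : ℝ, U * V = 1 →
      unit3 ^ 2 * U * (a - (α + β * V)) ^ 2 + (b - (γ + δ * U)) ^ 2 =
      unit3 ^ 2 * U * (a' - (α + β * V)) ^ 2 + (b' - (γ + δ * U)) ^ 2) (z : ℝ) :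
    axisCeil α β γ δ a b z = axisCeil α β γ δ a' b' z := by
  rw [axisCeil, axisCeil, sqDistCeil_eq, sqDistCeil_eq, h _ _ (by rw [← Real.exp_add]; simp)]

/-- On the axis every vertex is as far as one representative p at height 0 or one representative q
at height h. The difference of these two distances changes sign on [a, b], and a zero is the height
of a circumcentre. -/
theorem exists_circumsphere {A : Fin 4 → Sol} {α β γ δ p₁ p₂ q₁ q₂ a b M : ℝ}
    (ha : 0 < a) (hab : a ≤ b) (hb : b < height 3)
    (hA : ∀ i z, transDist (axis α β γ δ z) (A i) ^ 2 = axisFloor α β γ δ p₁ p₂ z ∨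
      transDist (axis α β γ δ z) (A i) ^ 2 = axisCeil α β γ δ q₁ q₂ z)
    (h₁ : axisFloor α β γ δ p₁ p₂ a ≤ axisCeil α β γ δ q₁ q₂ a)
    (h₂ : axisCeil α β γ δ q₁ q₂ b ≤ axisFloor α β γ δ p₁ p₂ b)
    (hM : ∀ z, a ≤ z → z ≤ b → axisFloor α β γ δ p₁ p₂ z ≤ M) :
    ∃ c r, IsCircumsphere A c r ∧ r ^ 2 ≤ M := by
  -- 0 < a and b < h keep both arguments z and h - z of `bern` positive, where the quotient formula
  -- shows continuity.
  have hg : ContinuousOn bern (Set.Icc a b) :=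
    continuousOn_bern.mono fun z hz => ha.trans_le hz.1
  have hw : ContinuousOn (fun z => bern (height 3 - z)) (Set.Icc a b) :=
    continuousOn_bern.comp (by fun_prop) fun z hz => sub_pos.2 (hz.2.trans_lt hb)
  have c0 : ContinuousOn (axisFloor α β γ δ p₁ p₂) (Set.Icc a b) := by
    unfold axisFloor
    simp only [sqDistFloor_eq]
    fun_prop
  have c1 : ContinuousOn (axisCeil α β γ δ q₁ q₂) (Set.Icc a b) := by
    unfold axisCeil
    simp only [sqDistCeil_eq]
    fun_prop
  obtain ⟨z, hz, h0⟩ := intermediate_value_Icc hab (c0.sub c1)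
    (show (0 : ℝ) ∈ Set.Icc _ _ from ⟨sub_nonpos.2 h₁, sub_nonneg.2 h₂⟩)
  have heq : axisFloor α β γ δ p₁ p₂ z = axisCeil α β γ δ q₁ q₂ z := sub_eq_zero.1 h0
  have hpos : 0 < axisFloor α β γ δ p₁ p₂ z := by
    have := ha.trans_le hz.1
    unfold axisFloor sqDistFloor
    positivity
  refine ⟨axis α β γ δ z, Real.sqrt (axisFloor α β γ δ p₁ p₂ z),
    ⟨Real.sqrt_pos.2 hpos, fun i => ?_⟩, ?_⟩
  · rw [← Real.sqrt_sq (transDist_nonneg (axis α β γ δ z) (A i))]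
    congr 1
    rcases hA i z with h | h
    · exact h
    · exact h.trans heq.symm
  · rw [Real.sq_sqrt hpos.le]
    exact hM z hz.1 hz.2

/-! ### Coordinates of the vertices and interval arithmetic -/

theorem tau₁_eq : tau₁ 0.79 0.2 = mk 0.79 0.2 0 := rfl

theorem tau₂_eq : tau₂ 0.79 0.2 3 = mk (0.79 * (3 - unit3)) (0.2 * unit3) 0 := by
  rw [tau₂, exp_height_three, exp_neg_height_three]

theorem mk_mul_mk (a b c a' b' c' : ℝ) : mk a b c * mk a' b' c' =
    mk (a' + a * Real.exp (-c')) (b' + b * Real.exp c') (c' + c) := rfl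

theorem mk_floor_mul_mk_floor (a b a' b' : ℝ) : mk a b 0 * mk a' b' 0 =
    mk (a + a') (b + b') 0 := by
  rw [mk_mul_mk]; simp [add_comm]

theorem mk_floor_mul_tau₃ (a b : ℝ) : mk a b 0 * tau₃ 3 =
    mk (a * (3 - unit3)) (b * unit3) (height 3) := by
  rw [tau₃, mk_mul_mk, exp_height_three, exp_neg_height_three]; simp

theorem tetrahedron_eq : tetrahedron 0.79 0.2 3 =
    let E := unit3
    let h := height 3
    let O := mk 0 0 0
    let P := mk 0.79 0.2 0
    let P' := mk (0.79 * (3 - E)) (0.2 * E) 0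
    let Q := mk (0.79 * (4 - E)) (0.2 * (1 + E)) 0
    let P₃ := mk 0 0 h
    let Pτ := mk (0.79 * (3 - E)) (0.2 * E) h
    let P'τ := mk (0.79 * (8 - 3 * E)) (0.2 * (3 * E - 1)) h
    let Qτ := mk (0.79 * (11 - 4 * E)) (0.2 * (4 * E - 1)) h
    ![![O, P₃, Pτ, P'τ], ![O, P, Pτ, P'], ![O, P', Pτ, P'τ],
      ![Qτ, Pτ, P', P], ![Qτ, Q, P', P], ![Qτ, P'τ, P', Pτ]] := by
  have hE := unit3_sq
  have e1 : (1 : Sol) = mk 0 0 0 := rfl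
  have e2 : mk 0.79 0.2 0 * mk (0.79 * (3 - unit3)) (0.2 * unit3) 0 =
      mk (0.79 * (4 - unit3)) (0.2 * (1 + unit3)) 0 := by
    rw [mk_floor_mul_mk_floor]; congr 1 <;> ring
  have e3 : mk (0.79 * (3 - unit3)) (0.2 * unit3) 0 * tau₃ 3 =
      mk (0.79 * (8 - 3 * unit3)) (0.2 * (3 * unit3 - 1)) (height 3) := by
    rw [mk_floor_mul_tau₃]; congr 1 <;> grind
  have e4 : mk (0.79 * (4 - unit3)) (0.2 * (1 + unit3)) 0 * tau₃ 3 =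
      mk (0.79 * (11 - 4 * unit3)) (0.2 * (4 * unit3 - 1)) (height 3) := by
    rw [mk_floor_mul_tau₃]; congr 1 <;> grind
  unfold tetrahedron
  simp only [tau₁_eq, tau₂_eq, e1, e2, e3, e4, mk_floor_mul_tau₃ 0.79 0.2]
  rfl

/-- Since `bern (-z) = bern z + z`, one bound g for `bern z` and one for z control both
coefficients. -/
theorem sqDistFloor_le {X Y z a b g dx dy : ℝ} (hz : 0 ≤ z) (zu : ℝ) (hzu : z ≤ zu)
    (hg : bern z ≤ g) (hx : |a - X| ≤ dx) (hy : |b - Y| ≤ dy) :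
    sqDistFloor X Y z a b ≤ ((g + zu) * dx) ^ 2 + (g * dy) ^ 2 + zu ^ 2 := by
  have := bern_pos z
  rw [sqDistFloor, bern_neg, mul_pow (bern z + z), mul_pow (bern z), mul_pow (g + zu), mul_pow g,
    ← sq_abs (a - X), ← sq_abs (b - Y)]
  gcongr

theorem le_sqDistFloor {X Y z a b g dx dy : ℝ} (zl : ℝ) (hz : 0 ≤ zl) (hzl : zl ≤ z)
    (hg0 : 0 ≤ g) (hg : g ≤ bern z) (hx0 : 0 ≤ dx) (hy0 : 0 ≤ dy)
    (hx : dx ≤ |a - X|) (hy : dy ≤ |b - Y|) :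
    ((g + zl) * dx) ^ 2 + (g * dy) ^ 2 + zl ^ 2 ≤ sqDistFloor X Y z a b := by
  rw [sqDistFloor, bern_neg, mul_pow (bern z + z), mul_pow (bern z), mul_pow (g + zl), mul_pow g,
    ← sq_abs (a - X), ← sq_abs (b - Y)]
  gcongr

theorem sqDistCeil_le {X Y w a b g dx dy : ℝ} (hw : 0 ≤ w) (wu : ℝ) (hwu : w ≤ wu)
    (hg : bern w ≤ g) (hx : |a - X| ≤ dx) (hy : |b - Y| ≤ dy) :
    sqDistCeil unit3 X Y w a b ≤ (2.618033988749895 * g * dx) ^ 2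
      + (0.381966011250106 * (g + wu) * dy) ^ 2 + wu ^ 2 := by
  have := bern_pos w
  have hE := unit3_bounds
  have hE' : 3 - unit3 ≤ 0.381966011250106 := by linarith [hE.1]
  have hE0 : 0 ≤ 3 - unit3 := by linarith [hE.2]
  have := unit3_pos
  rw [sqDistCeil, unit3_inv, bern_neg, mul_pow (unit3 * bern w), mul_pow ((3 - unit3) * _),
    ← sq_abs (a - X), ← sq_abs (b - Y), mul_pow (_ * g), mul_pow (_ * (g + wu))]
  gcongr
  exact hE.2.le

theorem le_sqDistCeil {X Y w a b g dx dy : ℝ} (wl : ℝ) (hw : 0 ≤ wl) (hwl : wl ≤ w)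
    (hg0 : 0 ≤ g) (hg : g ≤ bern w) (hx0 : 0 ≤ dx) (hy0 : 0 ≤ dy)
    (hx : dx ≤ |a - X|) (hy : dy ≤ |b - Y|) :
    (2.618033988749894 * g * dx) ^ 2
      + (0.381966011250105 * (g + wl) * dy) ^ 2 + wl ^ 2 ≤ sqDistCeil unit3 X Y w a b := by
  have hE := unit3_bounds
  have hE0 := unit3_pos
  have hE' : 0.381966011250105 ≤ 3 - unit3 := by linarith [hE.2]
  rw [sqDistCeil, unit3_inv, bern_neg, mul_pow (unit3 * bern w), mul_pow ((3 - unit3) * _),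
    ← sq_abs (a - X), ← sq_abs (b - Y), mul_pow (_ * g), mul_pow (_ * (g + wl))]
  gcongr
  exact hE.1.le

/-- Bounds for `α + β * V` with `0 ≤ β`. -/
theorem affine_bounds {α β V αl αu βl βu vl vu : ℝ} (h1 : αl ≤ α) (h2 : α ≤ αu)
    (h3 : βl ≤ β) (h4 : β ≤ βu) (h5 : vl ≤ V) (h6 : V ≤ vu) (hβ : 0 ≤ βl) (hv : 0 ≤ vl) :
    αl + βl * vl ≤ α + β * V ∧ α + β * V ≤ αu + βu * vu :=
  ⟨add_le_add h1 (mul_le_mul h3 h5 hv (hβ.trans h3)),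
   add_le_add h2 (mul_le_mul h4 h6 (hv.trans h5) (hβ.trans (h3.trans h4)))⟩

/-- Bounds for `α - β * V` with `0 ≤ β`. -/
theorem affine_bounds_neg {α β V αl αu βl βu vl vu : ℝ} (h1 : αl ≤ α) (h2 : α ≤ αu)
    (h3 : βl ≤ -β) (h4 : -β ≤ βu) (h5 : vl ≤ V) (h6 : V ≤ vu) (hβ : 0 ≤ βl) (hv : 0 ≤ vl) :
    αl - βu * vu ≤ α + β * V ∧ α + β * V ≤ αu - βl * vl := by
  have e1 := mul_le_mul h3 h5 hv (hβ.trans h3)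
  have e2 := mul_le_mul h4 h6 (hv.trans h5) (hβ.trans (h3.trans h4))
  constructor <;> linarith

theorem enclosure_030 : Enclosure 0.3 1.822116 1.82212 0.548811 0.548813 0.857488 0.857491 0.705089 0.705091 := by
  apply Enclosure.of_mem (a := 0.3) (b := 0.3) (l := 1.349858) (u := 1.349859) (hl := exp_bounds_030.1)
    (hu := exp_bounds_030.2) <;> norm_num

theorem enclosure_045 : Enclosure 0.45 2.459602 2.459606 0.406569 0.40657 0.791817 0.791819 0.765574 0.765576 := by
  apply Enclosure.of_mem (a := 0.45) (b := 0.45) (l := 1.568312) (u := 1.568313) (hl := exp_bounds_045.1)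
    (hu := exp_bounds_045.2) <;> norm_num

theorem enclosure_054 : Enclosure 0.54 2.944676 2.944681 0.339595 0.339596 0.754182 0.754184 0.803613 0.803615 := by
  apply Enclosure.of_mem (a := 0.54) (b := 0.54) (l := 1.716006) (u := 1.716007) (hl := exp_bounds_054.1)
    (hu := exp_bounds_054.2) <;> norm_num

theorem enclosure_064 : Enclosure 0.64 3.596636 3.596641 0.278037 0.278038 0.713902 0.713904 0.847434 0.847437 := by
  apply Enclosure.of_mem (a := 0.64) (b := 0.64) (l := 1.896480) (u := 1.896481) (hl := exp_bounds_064.1)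
    (hu := exp_bounds_064.2) <;> norm_num

theorem enclosure_030_045 {z : ℝ} (h₁ : 0.3 ≤ z) (h₂ : z ≤ 0.45) :
    Enclosure z 1.822116 2.459606 0.406569 0.548813 0.791817 0.857491 0.705089 0.765576 := by
  apply Enclosure.of_mem (haz := h₁) (hzb := h₂) (l := 1.349858) (u := 1.568313) (hl := exp_bounds_030.1)
    (hu := exp_bounds_045.2) <;> norm_num

theorem enclosure_054_064 {z : ℝ} (h₁ : 0.54 ≤ z) (h₂ : z ≤ 0.64) :
    Enclosure z 2.944676 3.596641 0.278037 0.339596 0.713902 0.754184 0.803613 0.847437 := by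
  apply Enclosure.of_mem (haz := h₁) (hzb := h₂) (l := 1.716006) (u := 1.896481) (hl := exp_bounds_054.1)
    (hu := exp_bounds_064.2) <;> norm_num

theorem enclosure_056271755 : Enclosure 0.56271755 3.0815573428721 3.0815573428725 0.3245112417956 0.3245112417957 0.7448905924953 0.7448905924955 0.8134253802906 0.8134253802911 := by
  apply Enclosure.of_mem (a := 0.56271755) (b := 0.56271755) (l := 1.7554365106355) (u := 1.7554365106356) (hl := exp_bounds_056271755.1)
    (hu := exp_bounds_056271755.2) <;> norm_num

theorem enclosure_056271756 : Enclosure 0.56271756 3.0815574045034 3.0815574045038 0.3245112353053 0.3245112353055 0.7448905884234 0.7448905884236 0.813425384628 0.8134253846285 := by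
  apply Enclosure.of_mem (a := 0.56271756) (b := 0.56271756) (l := 1.7554365281899) (u := 1.7554365281900) (hl := exp_bounds_056271756.1)
    (hu := exp_bounds_056271756.2) <;> norm_num

theorem enclosure_056271755_056271756 {z : ℝ} (h₁ : 0.56271755 ≤ z) (h₂ : z ≤ 0.56271756) :
    Enclosure z 3.0815573428721 3.0815574045038 0.3245112353053 0.3245112417957 0.7448905884234 0.7448905924955 0.8134253802906 0.8134253846285 := by
  apply Enclosure.of_mem (haz := h₁) (hzb := h₂) (l := 1.7554365106355) (u := 1.7554365281900) (hl := exp_bounds_056271755.1)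
    (hu := exp_bounds_056271756.2) <;> norm_num

/-! ### Circumspheres of the six tetrahedra -/

/-- The bound 0.645 serves the five smaller tetrahedra alike. It only has to lie below the value of
r² for index 4, so a wide bracket for z is enough. -/
theorem exists_circumsphere_tetrahedron_0 : ∃ c r,
    IsCircumsphere (tetrahedron 0.79 0.2 3 0) c r ∧ r ^ 2 ≤ 0.645 := by
  have hE := unit3_bounds
  have hE2 := unit3_sq
  have hh := height_three_bounds
  -- The four coefficients solve the linear equations for the three vertices at height h, reduced
  -- modulo E² = 3E - 1; the floor representative is O.
  refine exists_circumsphere (α := 869 / 250 - 158 / 125 * unit3) (β := 8 / 395 - 22 / 395 * unit3)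
    (γ := -2 / 25 + 8 / 25 * unit3) (δ := -180989 / 20000 + 68651 / 20000 * unit3)
    (p₁ := 0) (p₂ := 0) (q₁ := 0.79 * (8 - 3 * unit3)) (q₂ := 0.2 * (3 * unit3 - 1))
    (a := 0.3) (b := 0.45) (by norm_num) (by norm_num) (by linarith) ?_ ?_ ?_ ?_
  · intro i z
    rw [tetrahedron_eq]
    fin_cases i
    · exact Or.inl (transDist_axis_floor _ _ _ _ _ _ _)
    · exact Or.inr ((transDist_axis_ceil _ _ _ _ _ _ _).trans
        (axisCeil_congr (fun U V h => by grind) _))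
    · exact Or.inr ((transDist_axis_ceil _ _ _ _ _ _ _).trans
        (axisCeil_congr (fun U V h => by grind) _))
    · exact Or.inr (transDist_axis_ceil _ _ _ _ _ _ _)
  · have e := enclosure_030
    have hX := affine_bounds_neg (αl := 0.166805038) (αu := 0.166805039)
      (βl := 0.125561386) (βu := 0.125561387)
      (show _ ≤ 869 / 250 - 158 / 125 * unit3 by linarith) (show 869 / 250 - 158 / 125 * unit3 ≤ _ by linarith)
      (show _ ≤ -(8 / 395 - 22 / 395 * unit3) by linarith) (show -(8 / 395 - 22 / 395 * unit3) ≤ _ by linarith)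
      e.vl e.vu (by norm_num) (by norm_num)
    norm_num at hX
    have hY := affine_bounds_neg (αl := 0.757770876) (αu := 0.757770877)
      (βl := 0.062917431) (βu := 0.062917432)
      (show _ ≤ -2 / 25 + 8 / 25 * unit3 by linarith) (show -2 / 25 + 8 / 25 * unit3 ≤ _ by linarith)
      (show _ ≤ -(-180989 / 20000 + 68651 / 20000 * unit3) by linarith) (show -(-180989 / 20000 + 68651 / 20000 * unit3) ≤ _ by linarith)
      e.ul e.uu (by norm_num) (by norm_num)
    norm_num at hY
    -- dx and dy are the horizontal offsets of the axis from the vertex, rounded up on the smaller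
    -- side and down on the larger one.
    refine (sqDistFloor_le (dx := 0.0979) (dy := 0.64313) (by norm_num) 0.3 le_rfl e.gu
      (abs_le.2 ⟨by linarith, by linarith⟩) (abs_le.2 ⟨by linarith, by linarith⟩)).trans (le_trans ?_
      (le_sqDistCeil (dx := 0.01736) (dy := 0.72769) 0.6624236501192 (by norm_num) (by linarith)
      (by norm_num) e.wl (by norm_num) (by norm_num)
      (le_abs.2 (Or.inl (by linarith))) (le_abs.2 (Or.inl (by linarith)))))
    norm_num
  · have e := enclosure_045
    have hX := affine_bounds_neg (αl := 0.166805038) (αu := 0.166805039)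
      (βl := 0.125561386) (βu := 0.125561387)
      (show _ ≤ 869 / 250 - 158 / 125 * unit3 by linarith) (show 869 / 250 - 158 / 125 * unit3 ≤ _ by linarith)
      (show _ ≤ -(8 / 395 - 22 / 395 * unit3) by linarith) (show -(8 / 395 - 22 / 395 * unit3) ≤ _ by linarith)
      e.vl e.vu (by norm_num) (by norm_num)
    norm_num at hX
    have hY := affine_bounds_neg (αl := 0.757770876) (αu := 0.757770877)
      (βl := 0.062917431) (βu := 0.062917432)
      (show _ ≤ -2 / 25 + 8 / 25 * unit3 by linarith) (show -2 / 25 + 8 / 25 * unit3 ≤ _ by linarith)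
      (show _ ≤ -(-180989 / 20000 + 68651 / 20000 * unit3) by linarith) (show -(-180989 / 20000 + 68651 / 20000 * unit3) ≤ _ by linarith)
      e.ul e.uu (by norm_num) (by norm_num)
    norm_num at hY
    refine (sqDistCeil_le (dx := 0.0005) (dy := 0.76781) (by linarith) 0.5124236501193 (by linarith) e.wu
      (abs_le.2 ⟨by linarith, by linarith⟩) (abs_le.2 ⟨by linarith, by linarith⟩)).trans (le_trans ?_
      (le_sqDistFloor (dx := 0.11575) (dy := 0.60301) 0.45 (by norm_num) le_rfl
      (by norm_num) e.gl (by norm_num) (by norm_num)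
      (le_abs.2 (Or.inr (by linarith))) (le_abs.2 (Or.inr (by linarith)))))
    norm_num
  · intro z hz1 hz2
    have e := enclosure_030_045 hz1 hz2
    have hX := affine_bounds_neg (αl := 0.166805038) (αu := 0.166805039)
      (βl := 0.125561386) (βu := 0.125561387)
      (show _ ≤ 869 / 250 - 158 / 125 * unit3 by linarith) (show 869 / 250 - 158 / 125 * unit3 ≤ _ by linarith)
      (show _ ≤ -(8 / 395 - 22 / 395 * unit3) by linarith) (show -(8 / 395 - 22 / 395 * unit3) ≤ _ by linarith)
      e.vl e.vu (by norm_num) (by norm_num)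
    norm_num at hX
    have hY := affine_bounds_neg (αl := 0.757770876) (αu := 0.757770877)
      (βl := 0.062917431) (βu := 0.062917432)
      (show _ ≤ -2 / 25 + 8 / 25 * unit3 by linarith) (show -2 / 25 + 8 / 25 * unit3 ≤ _ by linarith)
      (show _ ≤ -(-180989 / 20000 + 68651 / 20000 * unit3) by linarith) (show -(-180989 / 20000 + 68651 / 20000 * unit3) ≤ _ by linarith)
      e.ul e.uu (by norm_num) (by norm_num)
    norm_num at hY
    refine (sqDistFloor_le (dx := 0.11576) (dy := 0.64313) (by linarith) 0.45 hz2 e.gu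
      (abs_le.2 ⟨by linarith, by linarith⟩) (abs_le.2 ⟨by linarith, by linarith⟩)).trans ?_
    norm_num

/-- Here three vertices lie at height 0 and determine the axis. -/
theorem exists_circumsphere_tetrahedron_1 : ∃ c r,
    IsCircumsphere (tetrahedron 0.79 0.2 3 1) c r ∧ r ^ 2 ≤ 0.645 := by
  have hE := unit3_bounds
  have hE2 := unit3_sq
  have hh := height_three_bounds
  refine exists_circumsphere (α := 158 / 125 - 79 / 250 * unit3) (β := 2 / 395 - 8 / 395 * unit3)
    (γ := 2 / 25 + 2 / 25 * unit3) (δ := -68651 / 20000 + 6241 / 5000 * unit3)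
    (p₁ := 0) (p₂ := 0) (q₁ := 0.79 * (3 - unit3)) (q₂ := 0.2 * unit3)
    (a := 0.3) (b := 0.45) (by norm_num) (by norm_num) (by linarith) ?_ ?_ ?_ ?_
  · intro i z
    rw [tetrahedron_eq]
    fin_cases i
    · exact Or.inl (transDist_axis_floor _ _ _ _ _ _ _)
    · exact Or.inl ((transDist_axis_floor _ _ _ _ _ _ _).trans
        (axisFloor_congr (fun U V h => by grind) _))
    · exact Or.inr (transDist_axis_ceil _ _ _ _ _ _ _)
    · exact Or.inl ((transDist_axis_floor _ _ _ _ _ _ _).trans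
        (axisFloor_congr (fun U V h => by grind) _))
  · have e := enclosure_030
    have hX := affine_bounds_neg (αl := 0.436701259) (αu := 0.43670126)
      (βl := 0.047960182) (βu := 0.047960183)
      (show _ ≤ 158 / 125 - 79 / 250 * unit3 by linarith) (show 158 / 125 - 79 / 250 * unit3 ≤ _ by linarith)
      (show _ ≤ -(2 / 395 - 8 / 395 * unit3) by linarith) (show -(2 / 395 - 8 / 395 * unit3) ≤ _ by linarith)
      e.vl e.vu (by norm_num) (by norm_num)
    norm_num at hX
    have hY := affine_bounds_neg (αl := 0.289442719) (αu := 0.28944272)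
      (βl := 0.164719975) (βu := 0.164719976)
      (show _ ≤ 2 / 25 + 2 / 25 * unit3 by linarith) (show 2 / 25 + 2 / 25 * unit3 ≤ _ by linarith)
      (show _ ≤ -(-68651 / 20000 + 6241 / 5000 * unit3) by linarith) (show -(-68651 / 20000 + 6241 / 5000 * unit3) ≤ _ by linarith)
      e.ul e.uu (by norm_num) (by norm_num)
    norm_num at hY
    refine (sqDistFloor_le (dx := 0.41039) (dy := 0.0107) (by norm_num) 0.3 le_rfl e.gu
      (abs_le.2 ⟨by linarith, by linarith⟩) (abs_le.2 ⟨by linarith, by linarith⟩)).trans (le_trans ?_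
      (le_sqDistCeil (dx := 0.10862) (dy := 0.5343) 0.6624236501192 (by norm_num) (by linarith)
      (by norm_num) e.wl (by norm_num) (by norm_num)
      (le_abs.2 (Or.inr (by linarith))) (le_abs.2 (Or.inl (by linarith)))))
    norm_num
  · have e := enclosure_045
    have hX := affine_bounds_neg (αl := 0.436701259) (αu := 0.43670126)
      (βl := 0.047960182) (βu := 0.047960183)
      (show _ ≤ 158 / 125 - 79 / 250 * unit3 by linarith) (show 158 / 125 - 79 / 250 * unit3 ≤ _ by linarith)
      (show _ ≤ -(2 / 395 - 8 / 395 * unit3) by linarith) (show -(2 / 395 - 8 / 395 * unit3) ≤ _ by linarith)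
      e.vl e.vu (by norm_num) (by norm_num)
    norm_num at hX
    have hY := affine_bounds_neg (αl := 0.289442719) (αu := 0.28944272)
      (βl := 0.164719975) (βu := 0.164719976)
      (show _ ≤ 2 / 25 + 2 / 25 * unit3 by linarith) (show 2 / 25 + 2 / 25 * unit3 ≤ _ by linarith)
      (show _ ≤ -(-68651 / 20000 + 6241 / 5000 * unit3) by linarith) (show -(-68651 / 20000 + 6241 / 5000 * unit3) ≤ _ by linarith)
      e.ul e.uu (by norm_num) (by norm_num)
    norm_num at hY
    refine (sqDistCeil_le (dx := 0.11545) (dy := 0.63932) (by linarith) 0.5124236501193 (by linarith) e.wu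
      (abs_le.2 ⟨by linarith, by linarith⟩) (abs_le.2 ⟨by linarith, by linarith⟩)).trans (le_trans ?_
      (le_sqDistFloor (dx := 0.4172) (dy := 0.1157) 0.45 (by norm_num) le_rfl
      (by norm_num) e.gl (by norm_num) (by norm_num)
      (le_abs.2 (Or.inr (by linarith))) (le_abs.2 (Or.inl (by linarith)))))
    norm_num
  · intro z hz1 hz2
    have e := enclosure_030_045 hz1 hz2
    have hX := affine_bounds_neg (αl := 0.436701259) (αu := 0.43670126)
      (βl := 0.047960182) (βu := 0.047960183)
      (show _ ≤ 158 / 125 - 79 / 250 * unit3 by linarith) (show 158 / 125 - 79 / 250 * unit3 ≤ _ by linarith)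
      (show _ ≤ -(2 / 395 - 8 / 395 * unit3) by linarith) (show -(2 / 395 - 8 / 395 * unit3) ≤ _ by linarith)
      e.vl e.vu (by norm_num) (by norm_num)
    norm_num at hX
    have hY := affine_bounds_neg (αl := 0.289442719) (αu := 0.28944272)
      (βl := 0.164719975) (βu := 0.164719976)
      (show _ ≤ 2 / 25 + 2 / 25 * unit3 by linarith) (show 2 / 25 + 2 / 25 * unit3 ≤ _ by linarith)
      (show _ ≤ -(-68651 / 20000 + 6241 / 5000 * unit3) by linarith) (show -(-68651 / 20000 + 6241 / 5000 * unit3) ≤ _ by linarith)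
      e.ul e.uu (by norm_num) (by norm_num)
    norm_num at hY
    refine (sqDistFloor_le (dx := 0.41721) (dy := 0.11571) (by linarith) 0.45 hz2 e.gu
      (abs_le.2 ⟨by linarith, by linarith⟩) (abs_le.2 ⟨by linarith, by linarith⟩)).trans ?_
    norm_num

/-- Two vertices lie at each height, and each pair contributes one linear equation for the axis. -/
theorem exists_circumsphere_tetrahedron_2 : ∃ c r,
    IsCircumsphere (tetrahedron 0.79 0.2 3 2) c r ∧ r ^ 2 ≤ 0.645 := by
  have hE := unit3_bounds
  have hE2 := unit3_sq
  have hh := height_three_bounds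
  refine exists_circumsphere (α := 1027 / 500 - 711 / 1000 * unit3) (β := 22 / 395 - 58 / 395 * unit3)
    (γ := -1 / 50 + 9 / 50 * unit3) (δ := -118579 / 5000 + 180989 / 20000 * unit3)
    (p₁ := 0) (p₂ := 0) (q₁ := 0.79 * (8 - 3 * unit3)) (q₂ := 0.2 * (3 * unit3 - 1))
    (a := 0.54) (b := 0.64) (by norm_num) (by norm_num) (by linarith) ?_ ?_ ?_ ?_
  · intro i z
    rw [tetrahedron_eq]
    fin_cases i
    · exact Or.inl (transDist_axis_floor _ _ _ _ _ _ _)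
    · exact Or.inl ((transDist_axis_floor _ _ _ _ _ _ _).trans
        (axisFloor_congr (fun U V h => by grind) _))
    · exact Or.inr ((transDist_axis_ceil _ _ _ _ _ _ _).trans
        (axisCeil_congr (fun U V h => by grind) _))
    · exact Or.inr (transDist_axis_ceil _ _ _ _ _ _ _)
  · have e := enclosure_054
    have hX := affine_bounds_neg (αl := 0.192577833) (αu := 0.192577834)
      (βl := 0.328723978) (βu := 0.328723979)
      (show _ ≤ 1027 / 500 - 711 / 1000 * unit3 by linarith) (show 1027 / 500 - 711 / 1000 * unit3 ≤ _ by linarith)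
      (show _ ≤ -(22 / 395 - 58 / 395 * unit3) by linarith) (show -(22 / 395 - 58 / 395 * unit3) ≤ _ by linarith)
      e.vl e.vu (by norm_num) (by norm_num)
    norm_num at hX
    have hY := affine_bounds_neg (αl := 0.451246117) (αu := 0.451246118)
      (βl := 0.02403232) (βu := 0.024032321)
      (show _ ≤ -1 / 50 + 9 / 50 * unit3 by linarith) (show -1 / 50 + 9 / 50 * unit3 ≤ _ by linarith)
      (show _ ≤ -(-118579 / 5000 + 180989 / 20000 * unit3) by linarith) (show -(-118579 / 5000 + 180989 / 20000 * unit3) ≤ _ by linarith)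
      e.ul e.uu (by norm_num) (by norm_num)
    norm_num at hY
    refine (sqDistFloor_le (dx := 0.08095) (dy := 0.38048) (by norm_num) 0.54 le_rfl e.gu
      (abs_le.2 ⟨by linarith, by linarith⟩) (abs_le.2 ⟨by linarith, by linarith⟩)).trans (le_trans ?_
      (le_sqDistCeil (dx := 0.03431) (dy := 0.99034) 0.4224236501192 (by norm_num) (by linarith)
      (by norm_num) e.wl (by norm_num) (by norm_num)
      (le_abs.2 (Or.inl (by linarith))) (le_abs.2 (Or.inl (by linarith)))))
    norm_num
  · have e := enclosure_064
    have hX := affine_bounds_neg (αl := 0.192577833) (αu := 0.192577834)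
      (βl := 0.328723978) (βu := 0.328723979)
      (show _ ≤ 1027 / 500 - 711 / 1000 * unit3 by linarith) (show 1027 / 500 - 711 / 1000 * unit3 ≤ _ by linarith)
      (show _ ≤ -(22 / 395 - 58 / 395 * unit3) by linarith) (show -(22 / 395 - 58 / 395 * unit3) ≤ _ by linarith)
      e.vl e.vu (by norm_num) (by norm_num)
    norm_num at hX
    have hY := affine_bounds_neg (αl := 0.451246117) (αu := 0.451246118)
      (βl := 0.02403232) (βu := 0.024032321)
      (show _ ≤ -1 / 50 + 9 / 50 * unit3 by linarith) (show -1 / 50 + 9 / 50 * unit3 ≤ _ by linarith)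
      (show _ ≤ -(-118579 / 5000 + 180989 / 20000 * unit3) by linarith) (show -(-118579 / 5000 + 180989 / 20000 * unit3) ≤ _ by linarith)
      e.ul e.uu (by norm_num) (by norm_num)
    norm_num at hY
    refine (sqDistCeil_le (dx := 0.01408) (dy := 1.00602) (by linarith) 0.3224236501193 (by linarith) e.wu
      (abs_le.2 ⟨by linarith, by linarith⟩) (abs_le.2 ⟨by linarith, by linarith⟩)).trans (le_trans ?_
      (le_sqDistFloor (dx := 0.10118) (dy := 0.36481) 0.64 (by norm_num) le_rfl
      (by norm_num) e.gl (by norm_num) (by norm_num)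
      (le_abs.2 (Or.inr (by linarith))) (le_abs.2 (Or.inr (by linarith)))))
    norm_num
  · intro z hz1 hz2
    have e := enclosure_054_064 hz1 hz2
    have hX := affine_bounds_neg (αl := 0.192577833) (αu := 0.192577834)
      (βl := 0.328723978) (βu := 0.328723979)
      (show _ ≤ 1027 / 500 - 711 / 1000 * unit3 by linarith) (show 1027 / 500 - 711 / 1000 * unit3 ≤ _ by linarith)
      (show _ ≤ -(22 / 395 - 58 / 395 * unit3) by linarith) (show -(22 / 395 - 58 / 395 * unit3) ≤ _ by linarith)
      e.vl e.vu (by norm_num) (by norm_num)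
    norm_num at hX
    have hY := affine_bounds_neg (αl := 0.451246117) (αu := 0.451246118)
      (βl := 0.02403232) (βu := 0.024032321)
      (show _ ≤ -1 / 50 + 9 / 50 * unit3 by linarith) (show -1 / 50 + 9 / 50 * unit3 ≤ _ by linarith)
      (show _ ≤ -(-118579 / 5000 + 180989 / 20000 * unit3) by linarith) (show -(-118579 / 5000 + 180989 / 20000 * unit3) ≤ _ by linarith)
      e.ul e.uu (by norm_num) (by norm_num)
    norm_num at hY
    refine (sqDistFloor_le (dx := 0.10119) (dy := 0.38048) (by linarith) 0.64 hz2 e.gu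
      (abs_le.2 ⟨by linarith, by linarith⟩) (abs_le.2 ⟨by linarith, by linarith⟩)).trans ?_
    norm_num

theorem exists_circumsphere_tetrahedron_3 : ∃ c r,
    IsCircumsphere (tetrahedron 0.79 0.2 3 3) c r ∧ r ^ 2 ≤ 0.645 := by
  have hE := unit3_bounds
  have hE2 := unit3_sq
  have hh := height_three_bounds
  refine exists_circumsphere (α := 553 / 125 - 1501 / 1000 * unit3) (β := -28 / 395 + 72 / 395 * unit3)
    (γ := -1 / 50 + 19 / 50 * unit3) (δ := 293327 / 10000 - 56169 / 5000 * unit3)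
    (p₁ := 0.79) (p₂ := 0.2) (q₁ := 0.79 * (3 - unit3)) (q₂ := 0.2 * unit3)
    (a := 0.54) (b := 0.64) (by norm_num) (by norm_num) (by linarith) ?_ ?_ ?_ ?_
  · intro i z
    rw [tetrahedron_eq]
    fin_cases i
    · exact Or.inr ((transDist_axis_ceil _ _ _ _ _ _ _).trans
        (axisCeil_congr (fun U V h => by grind) _))
    · exact Or.inr (transDist_axis_ceil _ _ _ _ _ _ _)
    · exact Or.inl ((transDist_axis_floor _ _ _ _ _ _ _).trans
        (axisFloor_congr (fun U V h => by grind) _))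
    · exact Or.inl (transDist_axis_floor _ _ _ _ _ _ _)
  · have e := enclosure_054
    have hX := affine_bounds (αl := 0.494330982) (αu := 0.494330983)
      (βl := 0.406325182) (βu := 0.406325183)
      (show _ ≤ 553 / 125 - 1501 / 1000 * unit3 by linarith) (show 553 / 125 - 1501 / 1000 * unit3 ≤ _ by linarith)
      (show _ ≤ (-28 / 395 + 72 / 395 * unit3) by linarith) (show (-28 / 395 + 72 / 395 * unit3) ≤ _ by linarith)
      e.vl e.vu (by norm_num) (by norm_num)
    norm_num at hX
    have hY := affine_bounds_neg (αl := 0.974852915) (αu := 0.974852916)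
      (βl := 0.077770222) (βu := 0.077770223)
      (show _ ≤ -1 / 50 + 19 / 50 * unit3 by linarith) (show -1 / 50 + 19 / 50 * unit3 ≤ _ by linarith)
      (show _ ≤ -(293327 / 10000 - 56169 / 5000 * unit3) by linarith) (show -(293327 / 10000 - 56169 / 5000 * unit3) ≤ _ by linarith)
      e.ul e.uu (by norm_num) (by norm_num)
    norm_num at hY
    refine (sqDistFloor_le (dx := 0.15769) (dy := 0.54585) (by norm_num) 0.54 le_rfl e.gu
      (abs_le.2 ⟨by linarith, by linarith⟩) (abs_le.2 ⟨by linarith, by linarith⟩)).trans (le_trans ?_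
      (le_sqDistCeil (dx := 0.33056) (dy := 0.22223) 0.4224236501192 (by norm_num) (by linarith)
      (by norm_num) e.wl (by norm_num) (by norm_num)
      (le_abs.2 (Or.inr (by linarith))) (le_abs.2 (Or.inr (by linarith)))))
    norm_num
  · have e := enclosure_064
    have hX := affine_bounds (αl := 0.494330982) (αu := 0.494330983)
      (βl := 0.406325182) (βu := 0.406325183)
      (show _ ≤ 553 / 125 - 1501 / 1000 * unit3 by linarith) (show 553 / 125 - 1501 / 1000 * unit3 ≤ _ by linarith)
      (show _ ≤ (-28 / 395 + 72 / 395 * unit3) by linarith) (show (-28 / 395 + 72 / 395 * unit3) ≤ _ by linarith)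
      e.vl e.vu (by norm_num) (by norm_num)
    norm_num at hX
    have hY := affine_bounds_neg (αl := 0.974852915) (αu := 0.974852916)
      (βl := 0.077770222) (βu := 0.077770223)
      (show _ ≤ -1 / 50 + 19 / 50 * unit3 by linarith) (show -1 / 50 + 19 / 50 * unit3 ≤ _ by linarith)
      (show _ ≤ -(293327 / 10000 - 56169 / 5000 * unit3) by linarith) (show -(293327 / 10000 - 56169 / 5000 * unit3) ≤ _ by linarith)
      e.ul e.uu (by norm_num) (by norm_num)
    norm_num at hY
    refine (sqDistCeil_le (dx := 0.30556) (dy := 0.17154) (by linarith) 0.3224236501193 (by linarith) e.wu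
      (abs_le.2 ⟨by linarith, by linarith⟩) (abs_le.2 ⟨by linarith, by linarith⟩)).trans (le_trans ?_
      (le_sqDistFloor (dx := 0.18269) (dy := 0.49514) 0.64 (by norm_num) le_rfl
      (by norm_num) e.gl (by norm_num) (by norm_num)
      (le_abs.2 (Or.inl (by linarith))) (le_abs.2 (Or.inr (by linarith)))))
    norm_num
  · intro z hz1 hz2
    have e := enclosure_054_064 hz1 hz2
    have hX := affine_bounds (αl := 0.494330982) (αu := 0.494330983)
      (βl := 0.406325182) (βu := 0.406325183)
      (show _ ≤ 553 / 125 - 1501 / 1000 * unit3 by linarith) (show 553 / 125 - 1501 / 1000 * unit3 ≤ _ by linarith)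
      (show _ ≤ (-28 / 395 + 72 / 395 * unit3) by linarith) (show (-28 / 395 + 72 / 395 * unit3) ≤ _ by linarith)
      e.vl e.vu (by norm_num) (by norm_num)
    norm_num at hX
    have hY := affine_bounds_neg (αl := 0.974852915) (αu := 0.974852916)
      (βl := 0.077770222) (βu := 0.077770223)
      (show _ ≤ -1 / 50 + 19 / 50 * unit3 by linarith) (show -1 / 50 + 19 / 50 * unit3 ≤ _ by linarith)
      (show _ ≤ -(293327 / 10000 - 56169 / 5000 * unit3) by linarith) (show -(293327 / 10000 - 56169 / 5000 * unit3) ≤ _ by linarith)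
      e.ul e.uu (by norm_num) (by norm_num)
    norm_num at hY
    refine (sqDistFloor_le (dx := 0.1827) (dy := 0.54585) (by linarith) 0.64 hz2 e.gu
      (abs_le.2 ⟨by linarith, by linarith⟩) (abs_le.2 ⟨by linarith, by linarith⟩)).trans ?_
    norm_num

/-- The ceiling triangles of this tetrahedron and of the one with index 0 are opposite halves of one
parallelogram. The two axes are therefore reflections of each other in its centre, and β and δ only
change sign. -/
theorem exists_circumsphere_tetrahedron_5 : ∃ c r,
    IsCircumsphere (tetrahedron 0.79 0.2 3 5) c r ∧ r ^ 2 ≤ 0.645 := by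
  have hE := unit3_bounds
  have hE2 := unit3_sq
  have hh := height_three_bounds
  refine exists_circumsphere (α := 2607 / 500 - 237 / 125 * unit3) (β := -8 / 395 + 22 / 395 * unit3)
    (γ := -3 / 25 + 12 / 25 * unit3) (δ := 180989 / 20000 - 68651 / 20000 * unit3)
    (p₁ := 0.79 * (3 - unit3)) (p₂ := 0.2 * unit3) (q₁ := 0.79 * (3 - unit3)) (q₂ := 0.2 * unit3)
    (a := 0.3) (b := 0.45) (by norm_num) (by norm_num) (by linarith) ?_ ?_ ?_ ?_
  · intro i z
    rw [tetrahedron_eq]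
    fin_cases i
    · exact Or.inr ((transDist_axis_ceil _ _ _ _ _ _ _).trans
        (axisCeil_congr (fun U V h => by grind) _))
    · exact Or.inr ((transDist_axis_ceil _ _ _ _ _ _ _).trans
        (axisCeil_congr (fun U V h => by grind) _))
    · exact Or.inl (transDist_axis_floor _ _ _ _ _ _ _)
    · exact Or.inr (transDist_axis_ceil _ _ _ _ _ _ _)
  · have e := enclosure_030
    have hX := affine_bounds (αl := 0.250207557) (αu := 0.250207558)
      (βl := 0.125561386) (βu := 0.125561387)
      (show _ ≤ 2607 / 500 - 237 / 125 * unit3 by linarith) (show 2607 / 500 - 237 / 125 * unit3 ≤ _ by linarith)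
      (show _ ≤ (-8 / 395 + 22 / 395 * unit3) by linarith) (show (-8 / 395 + 22 / 395 * unit3) ≤ _ by linarith)
      e.vl e.vu (by norm_num) (by norm_num)
    norm_num at hX
    have hY := affine_bounds (αl := 1.136656314) (αu := 1.136656315)
      (βl := 0.062917431) (βu := 0.062917432)
      (show _ ≤ -3 / 25 + 12 / 25 * unit3 by linarith) (show -3 / 25 + 12 / 25 * unit3 ≤ _ by linarith)
      (show _ ≤ (180989 / 20000 - 68651 / 20000 * unit3) by linarith) (show (180989 / 20000 - 68651 / 20000 * unit3) ≤ _ by linarith)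
      e.ul e.uu (by norm_num) (by norm_num)
    norm_num at hY
    refine (sqDistFloor_le (dx := 0.01737) (dy := 0.7277) (by norm_num) 0.3 le_rfl e.gu
      (abs_le.2 ⟨by linarith, by linarith⟩) (abs_le.2 ⟨by linarith, by linarith⟩)).trans (le_trans ?_
      (le_sqDistCeil (dx := 0.01736) (dy := 0.72769) 0.6624236501192 (by norm_num) (by linarith)
      (by norm_num) e.wl (by norm_num) (by norm_num)
      (le_abs.2 (Or.inr (by linarith))) (le_abs.2 (Or.inr (by linarith)))))
    norm_num
  · have e := enclosure_045
    have hX := affine_bounds (αl := 0.250207557) (αu := 0.250207558)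
      (βl := 0.125561386) (βu := 0.125561387)
      (show _ ≤ 2607 / 500 - 237 / 125 * unit3 by linarith) (show 2607 / 500 - 237 / 125 * unit3 ≤ _ by linarith)
      (show _ ≤ (-8 / 395 + 22 / 395 * unit3) by linarith) (show (-8 / 395 + 22 / 395 * unit3) ≤ _ by linarith)
      e.vl e.vu (by norm_num) (by norm_num)
    norm_num at hX
    have hY := affine_bounds (αl := 1.136656314) (αu := 1.136656315)
      (βl := 0.062917431) (βu := 0.062917432)
      (show _ ≤ -3 / 25 + 12 / 25 * unit3 by linarith) (show -3 / 25 + 12 / 25 * unit3 ≤ _ by linarith)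
      (show _ ≤ (180989 / 20000 - 68651 / 20000 * unit3) by linarith) (show (180989 / 20000 - 68651 / 20000 * unit3) ≤ _ by linarith)
      e.ul e.uu (by norm_num) (by norm_num)
    norm_num at hY
    refine (sqDistCeil_le (dx := 0.0005) (dy := 0.76781) (by linarith) 0.5124236501193 (by linarith) e.wu
      (abs_le.2 ⟨by linarith, by linarith⟩) (abs_le.2 ⟨by linarith, by linarith⟩)).trans (le_trans ?_
      (le_sqDistFloor (dx := 0.00049) (dy := 0.7678) 0.45 (by norm_num) le_rfl
      (by norm_num) e.gl (by norm_num) (by norm_num)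
      (le_abs.2 (Or.inl (by linarith))) (le_abs.2 (Or.inr (by linarith)))))
    norm_num
  · intro z hz1 hz2
    have e := enclosure_030_045 hz1 hz2
    have hX := affine_bounds (αl := 0.250207557) (αu := 0.250207558)
      (βl := 0.125561386) (βu := 0.125561387)
      (show _ ≤ 2607 / 500 - 237 / 125 * unit3 by linarith) (show 2607 / 500 - 237 / 125 * unit3 ≤ _ by linarith)
      (show _ ≤ (-8 / 395 + 22 / 395 * unit3) by linarith) (show (-8 / 395 + 22 / 395 * unit3) ≤ _ by linarith)
      e.vl e.vu (by norm_num) (by norm_num)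
    norm_num at hX
    have hY := affine_bounds (αl := 1.136656314) (αu := 1.136656315)
      (βl := 0.062917431) (βu := 0.062917432)
      (show _ ≤ -3 / 25 + 12 / 25 * unit3 by linarith) (show -3 / 25 + 12 / 25 * unit3 ≤ _ by linarith)
      (show _ ≤ (180989 / 20000 - 68651 / 20000 * unit3) by linarith) (show (180989 / 20000 - 68651 / 20000 * unit3) ≤ _ by linarith)
      e.ul e.uu (by norm_num) (by norm_num)
    norm_num at hY
    refine (sqDistFloor_le (dx := 0.01737) (dy := 0.76781) (by linarith) 0.45 hz2 e.gu
      (abs_le.2 ⟨by linarith, by linarith⟩) (abs_le.2 ⟨by linarith, by linarith⟩)).trans ?_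
    norm_num

/-- This tetrahedron determines R, so the root is enclosed in an interval of length 10⁻⁸. The axis
is that of the tetrahedron with index 1 reflected in the centre of the floor parallelogram. -/
theorem exists_circumsphere_tetrahedron_4 : ∃ c r,
    IsCircumsphere (tetrahedron 0.79 0.2 3 4) c r ∧ r ^ 2 ≤ 0.6463087201 := by
  have hE := unit3_bounds
  have hE2 := unit3_sq
  have hh := height_three_bounds
  refine exists_circumsphere (α := 237 / 125 - 237 / 500 * unit3) (β := -2 / 395 + 8 / 395 * unit3)
    (γ := 3 / 25 + 3 / 25 * unit3) (δ := 68651 / 20000 - 6241 / 5000 * unit3)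
    (p₁ := 0.79 * (4 - unit3)) (p₂ := 0.2 * (1 + unit3)) (q₁ := 0.79 * (11 - 4 * unit3)) (q₂ := 0.2 * (4 * unit3 - 1))
    (a := 0.56271755) (b := 0.56271756) (by norm_num) (by norm_num) (by linarith) ?_ ?_ ?_ ?_
  · intro i z
    rw [tetrahedron_eq]
    fin_cases i
    · exact Or.inr (transDist_axis_ceil _ _ _ _ _ _ _)
    · exact Or.inl (transDist_axis_floor _ _ _ _ _ _ _)
    · exact Or.inl ((transDist_axis_floor _ _ _ _ _ _ _).trans
        (axisFloor_congr (fun U V h => by grind) _))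
    · exact Or.inl ((transDist_axis_floor _ _ _ _ _ _ _).trans
        (axisFloor_congr (fun U V h => by grind) _))
  · have e := enclosure_056271755
    have hX := affine_bounds (αl := 0.6550518893325497) (αu := 0.6550518893325503)
      (βl := 0.0479601820506307) (βu := 0.0479601820506308)
      (show _ ≤ 237 / 125 - 237 / 500 * unit3 by linarith) (show 237 / 125 - 237 / 500 * unit3 ≤ _ by linarith)
      (show _ ≤ (-2 / 395 + 8 / 395 * unit3) by linarith) (show (-2 / 395 + 8 / 395 * unit3) ≤ _ by linarith)
      e.vl e.vu (by norm_num) (by norm_num)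
    norm_num at hX
    have hY := affine_bounds (αl := 0.4341640786499872) (αu := 0.4341640786499874)
      (βl := 0.164719975242381) (βu := 0.1647199752423824)
      (show _ ≤ 3 / 25 + 3 / 25 * unit3 by linarith) (show 3 / 25 + 3 / 25 * unit3 ≤ _ by linarith)
      (show _ ≤ (68651 / 20000 - 6241 / 5000 * unit3) by linarith) (show (68651 / 20000 - 6241 / 5000 * unit3) ≤ _ by linarith)
      e.ul e.uu (by norm_num) (by norm_num)
    norm_num at hY
    refine (sqDistFloor_le (dx := 0.4211376413211) (dy := 0.2181513301261) (by norm_num) 0.56271755 le_rfl e.gu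
      (abs_le.2 ⟨by linarith, by linarith⟩) (abs_le.2 ⟨by linarith, by linarith⟩)).trans (le_trans ?_
      (le_sqDistCeil (dx := 0.2536029120161) (dy := 0.9526690631239) 0.3997061001192 (by norm_num) (by linarith)
      (by norm_num) e.wl (by norm_num) (by norm_num)
      (le_abs.2 (Or.inr (by linarith))) (le_abs.2 (Or.inl (by linarith)))))
    norm_num
  · have e := enclosure_056271756
    have hX := affine_bounds (αl := 0.6550518893325497) (αu := 0.6550518893325503)
      (βl := 0.0479601820506307) (βu := 0.0479601820506308)
      (show _ ≤ 237 / 125 - 237 / 500 * unit3 by linarith) (show 237 / 125 - 237 / 500 * unit3 ≤ _ by linarith)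
      (show _ ≤ (-2 / 395 + 8 / 395 * unit3) by linarith) (show (-2 / 395 + 8 / 395 * unit3) ≤ _ by linarith)
      e.vl e.vu (by norm_num) (by norm_num)
    norm_num at hX
    have hY := affine_bounds (αl := 0.4341640786499872) (αu := 0.4341640786499874)
      (βl := 0.164719975242381) (βu := 0.1647199752423824)
      (show _ ≤ 3 / 25 + 3 / 25 * unit3 by linarith) (show 3 / 25 + 3 / 25 * unit3 ≤ _ by linarith)
      (show _ ≤ (68651 / 20000 - 6241 / 5000 * unit3) by linarith) (show (68651 / 20000 - 6241 / 5000 * unit3) ≤ _ by linarith)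
      e.ul e.uu (by norm_num) (by norm_num)
    norm_num at hY
    refine (sqDistCeil_le (dx := 0.253602911705) (dy := 0.9526690529723) (by linarith) 0.3997060901193 (by linarith) e.wu
      (abs_le.2 ⟨by linarith, by linarith⟩) (abs_le.2 ⟨by linarith, by linarith⟩)).trans (le_trans ?_
      (le_sqDistFloor (dx := 0.4211376416322) (dy := 0.2181513402777) 0.56271756 (by norm_num) le_rfl
      (by norm_num) e.gl (by norm_num) (by norm_num)
      (le_abs.2 (Or.inl (by linarith))) (le_abs.2 (Or.inr (by linarith)))))
    norm_num
  · intro z hz1 hz2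
    have e := enclosure_056271755_056271756 hz1 hz2
    have hX := affine_bounds (αl := 0.6550518893325497) (αu := 0.6550518893325503)
      (βl := 0.0479601820506307) (βu := 0.0479601820506308)
      (show _ ≤ 237 / 125 - 237 / 500 * unit3 by linarith) (show 237 / 125 - 237 / 500 * unit3 ≤ _ by linarith)
      (show _ ≤ (-2 / 395 + 8 / 395 * unit3) by linarith) (show (-2 / 395 + 8 / 395 * unit3) ≤ _ by linarith)
      e.vl e.vu (by norm_num) (by norm_num)
    norm_num at hX
    have hY := affine_bounds (αl := 0.4341640786499872) (αu := 0.4341640786499874)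
      (βl := 0.164719975242381) (βu := 0.1647199752423824)
      (show _ ≤ 3 / 25 + 3 / 25 * unit3 by linarith) (show 3 / 25 + 3 / 25 * unit3 ≤ _ by linarith)
      (show _ ≤ (68651 / 20000 - 6241 / 5000 * unit3) by linarith) (show (68651 / 20000 - 6241 / 5000 * unit3) ≤ _ by linarith)
      e.ul e.uu (by norm_num) (by norm_num)
    norm_num at hY
    refine (sqDistFloor_le (dx := 0.4211376416324) (dy := 0.218151340278) (by linarith) 0.56271756 hz2 e.gu
      (abs_le.2 ⟨by linarith, by linarith⟩) (abs_le.2 ⟨by linarith, by linarith⟩)).trans ?_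
    norm_num

/-! ### Lower bound for all circumspheres of the extremal tetrahedron -/

/-- The three floor vertices are not collinear, so the two linear equations have a unique solution;
no centre off the axis is possible. -/
theorem axis_of_equidistant {X Y z : ℝ}
    (h₁ : sqDistFloor X Y z (0.79 * (4 - unit3)) (0.2 * (1 + unit3)) =
      sqDistFloor X Y z (0.79 * (3 - unit3)) (0.2 * unit3))
    (h₂ : sqDistFloor X Y z (0.79 * (4 - unit3)) (0.2 * (1 + unit3)) = sqDistFloor X Y z 0.79 0.2) :
    X = 237 / 125 - 237 / 500 * unit3 + (-2 / 395 + 8 / 395 * unit3) * Real.exp (-(2 * z)) ∧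
      Y = 3 / 25 + 3 / 25 * unit3 + (68651 / 20000 - 6241 / 5000 * unit3) * Real.exp (2 * z) := by
  have hb : bern z ^ 2 ≠ 0 := (pow_pos (bern_pos z) 2).ne'
  rw [sqDistFloor_eq, sqDistFloor_eq] at h₁ h₂
  have h₁ := mul_left_cancel₀ hb (add_right_cancel h₁)
  have h₂ := mul_left_cancel₀ hb (add_right_cancel h₂)
  have hE := unit3_sq
  have hUV : Real.exp (2 * z) * Real.exp (-(2 * z)) = 1 := by rw [← Real.exp_add]; simp
  generalize Real.exp (2 * z) = U at *
  generalize Real.exp (-(2 * z)) = V at *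
  generalize unit3 = E at *
  constructor
  · grind
  · grind

/-- As z grows, the centre moves away from (a, b) in both coordinates and the factor `bern (-z)`
grows. The only competing effect is the decrease of `bern z` in the y-term, which z² outweighs by
`bern_sq_add_sq_le`. For the ceiling the roles of x and y are exchanged. -/
theorem sqDistFloor_mono {z₀ z X₀ X Y₀ Y a b : ℝ} (hz : z₀ ≤ z) (hX : X ≤ X₀) (hX₀ : X₀ ≤ a)
    (hY₀ : b ≤ Y₀) (hY : Y₀ ≤ Y) (hC : (Y₀ - b) ^ 2 * bern z₀ ≤ z₀) :
    sqDistFloor X₀ Y₀ z₀ a b ≤ sqDistFloor X Y z a b := by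
  have h1 : bern (-z₀) * (a - X₀) ≤ bern (-z) * (a - X) :=
    mul_le_mul (bern_neg_mono hz) (by linarith) (by linarith) (bern_pos _).le
  have h2 := pow_le_pow_left₀ (mul_nonneg (bern_pos _).le (by linarith)) h1 2
  have h3 := bern_sq_add_sq_le (sq_nonneg (Y₀ - b)) hC hz
  have h4 := mul_le_mul_of_nonneg_right
    (pow_le_pow_left₀ (by linarith) (by linarith : Y₀ - b ≤ Y - b) 2) (sq_nonneg (bern z))
  unfold sqDistFloor
  have e : ∀ y v, (bern v * (b - y)) ^ 2 = (y - b) ^ 2 * bern v ^ 2 := fun y v => by ring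
  rw [e, e]
  linarith

theorem sqDistCeil_mono {w₀ w X₀ X Y₀ Y a b : ℝ} (hw : w₀ ≤ w) (hX : X₀ ≤ X) (hX₀ : a ≤ X₀)
    (hY₀ : Y₀ ≤ b) (hY : Y ≤ Y₀) (hC : (unit3 * (X₀ - a)) ^ 2 * bern w₀ ≤ w₀) :
    sqDistCeil unit3 X₀ Y₀ w₀ a b ≤ sqDistCeil unit3 X Y w a b := by
  have hE := unit3_pos
  have h1 : unit3⁻¹ * bern (-w₀) * (b - Y₀) ≤ unit3⁻¹ * bern (-w) * (b - Y) :=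
    mul_le_mul (mul_le_mul_of_nonneg_left (bern_neg_mono hw) (inv_pos.2 hE).le) (by linarith)
      (by linarith) (mul_pos (inv_pos.2 hE) (bern_pos _)).le
  have h2 := pow_le_pow_left₀
    (mul_nonneg (mul_pos (inv_pos.2 hE) (bern_pos _)).le (by linarith)) h1 2
  have h3 := bern_sq_add_sq_le (sq_nonneg (unit3 * (X₀ - a))) hC hw
  have h4 := mul_le_mul_of_nonneg_right (pow_le_pow_left₀ (mul_nonneg hE.le (by linarith))
    (mul_le_mul_of_nonneg_left (by linarith : X₀ - a ≤ X - a) hE.le) 2) (sq_nonneg (bern w))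
  have e : ∀ x v, (unit3 * bern v * (a - x)) ^ 2 = (unit3 * (x - a)) ^ 2 * bern v ^ 2 :=
    fun x v => by ring
  unfold sqDistCeil
  rw [e, e]
  linarith

/-- β and δ are nonnegative, so along the axis X decreases and Y increases with z; the bound at the
left end of the bracket therefore persists for every larger z, without restriction to the slab. -/
theorem le_axisFloor_of_le {z : ℝ} (hz : 0.56271755 ≤ z) :
    0.6463087012 ≤ axisFloor (237 / 125 - 237 / 500 * unit3) (-2 / 395 + 8 / 395 * unit3) (3 / 25 + 3 / 25 * unit3)
      (68651 / 20000 - 6241 / 5000 * unit3) (0.79 * (4 - unit3)) (0.2 * (1 + unit3)) z := by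
  have hE := unit3_bounds
  have e := enclosure_056271755
  have hX := affine_bounds (αl := 0.6550518893325497) (αu := 0.6550518893325503)
    (βl := 0.0479601820506307) (βu := 0.0479601820506308)
    (show _ ≤ 237 / 125 - 237 / 500 * unit3 by linarith) (show 237 / 125 - 237 / 500 * unit3 ≤ _ by linarith)
    (show _ ≤ (-2 / 395 + 8 / 395 * unit3) by linarith) (show (-2 / 395 + 8 / 395 * unit3) ≤ _ by linarith)
    e.vl e.vu (by norm_num) (by norm_num)
  norm_num at hX
  have hY := affine_bounds (αl := 0.4341640786499872) (αu := 0.4341640786499874)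
    (βl := 0.164719975242381) (βu := 0.1647199752423824)
    (show _ ≤ 3 / 25 + 3 / 25 * unit3 by linarith) (show 3 / 25 + 3 / 25 * unit3 ≤ _ by linarith)
    (show _ ≤ (68651 / 20000 - 6241 / 5000 * unit3) by linarith) (show (68651 / 20000 - 6241 / 5000 * unit3) ≤ _ by linarith)
    e.ul e.uu (by norm_num) (by norm_num)
  norm_num at hY
  have h := le_sqDistFloor (X := 237 / 125 - 237 / 500 * unit3 + (-2 / 395 + 8 / 395 * unit3) * Real.exp (-(2 * 0.56271755)))
    (Y := 3 / 25 + 3 / 25 * unit3 + (68651 / 20000 - 6241 / 5000 * unit3) * Real.exp (2 * 0.56271755))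
    (a := 0.79 * (4 - unit3)) (b := 0.2 * (1 + unit3)) (dx := 0.4211376413209) (dy := 0.2181513301258)
    0.56271755 (by norm_num) le_rfl (by norm_num) e.gl (by norm_num) (by norm_num)
    (le_abs.2 (Or.inl (by linarith))) (le_abs.2 (Or.inr (by linarith)))
  refine le_trans (by norm_num) (h.trans ?_)
  have hU : Real.exp (2 * 0.56271755) ≤ Real.exp (2 * z) := Real.exp_le_exp.2 (by linarith)
  have hV : Real.exp (-(2 * z)) ≤ Real.exp (-(2 * 0.56271755)) := Real.exp_le_exp.2 (by linarith)
  have hβ : 0 ≤ -2 / 395 + 8 / 395 * unit3 := by linarith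
  have hδ : 0 ≤ 68651 / 20000 - 6241 / 5000 * unit3 := by linarith
  have hVβ := mul_le_mul_of_nonneg_left hV hβ
  have hUδ := mul_le_mul_of_nonneg_left hU hδ
  -- The smallness condition on C = (Y₀ - b)²: the offset is below 0.22, so C `bern z₀` is far below
  -- z₀.
  have hC := mul_le_mul (pow_le_pow_left₀ (by linarith) (show (3 / 25 + 3 / 25 * unit3 + (68651 / 20000 - 6241 / 5000 * unit3) * Real.exp (2 * 0.56271755)) -
      0.2 * (1 + unit3) ≤ (0.22 : ℝ) by linarith) 2)
    e.gu (bern_pos _).le (by norm_num)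
  exact sqDistFloor_mono hz (by linarith) (by linarith) (by linarith) (by linarith)
    (hC.trans (by norm_num))

theorem le_axisCeil_of_le {z : ℝ} (hz : z ≤ 0.56271755) :
    0.6463087012 ≤ axisCeil (237 / 125 - 237 / 500 * unit3) (-2 / 395 + 8 / 395 * unit3) (3 / 25 + 3 / 25 * unit3)
      (68651 / 20000 - 6241 / 5000 * unit3) (0.79 * (11 - 4 * unit3)) (0.2 * (4 * unit3 - 1)) z := by
  have hE := unit3_bounds
  have hh := height_three_bounds
  have hE0 := unit3_pos
  have e := enclosure_056271755
  have hX := affine_bounds (αl := 0.6550518893325497) (αu := 0.6550518893325503)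
    (βl := 0.0479601820506307) (βu := 0.0479601820506308)
    (show _ ≤ 237 / 125 - 237 / 500 * unit3 by linarith) (show 237 / 125 - 237 / 500 * unit3 ≤ _ by linarith)
    (show _ ≤ (-2 / 395 + 8 / 395 * unit3) by linarith) (show (-2 / 395 + 8 / 395 * unit3) ≤ _ by linarith)
    e.vl e.vu (by norm_num) (by norm_num)
  norm_num at hX
  have hY := affine_bounds (αl := 0.4341640786499872) (αu := 0.4341640786499874)
    (βl := 0.164719975242381) (βu := 0.1647199752423824)
    (show _ ≤ 3 / 25 + 3 / 25 * unit3 by linarith) (show 3 / 25 + 3 / 25 * unit3 ≤ _ by linarith)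
    (show _ ≤ (68651 / 20000 - 6241 / 5000 * unit3) by linarith) (show (68651 / 20000 - 6241 / 5000 * unit3) ≤ _ by linarith)
    e.ul e.uu (by norm_num) (by norm_num)
  norm_num at hY
  have h := le_sqDistCeil (X := 237 / 125 - 237 / 500 * unit3 + (-2 / 395 + 8 / 395 * unit3) * Real.exp (-(2 * 0.56271755)))
    (Y := 3 / 25 + 3 / 25 * unit3 + (68651 / 20000 - 6241 / 5000 * unit3) * Real.exp (2 * 0.56271755))
    (w := height 3 - 0.56271755)
    (a := 0.79 * (11 - 4 * unit3)) (b := 0.2 * (4 * unit3 - 1)) (dx := 0.2536029120161) (dy := 0.9526690631239)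
    0.3997061001192 (by norm_num) (by linarith) (by norm_num) e.wl (by norm_num) (by norm_num)
    (le_abs.2 (Or.inr (by linarith))) (le_abs.2 (Or.inl (by linarith)))
  refine le_trans (by norm_num) (h.trans ?_)
  have hU : Real.exp (2 * z) ≤ Real.exp (2 * 0.56271755) := Real.exp_le_exp.2 (by linarith)
  have hV : Real.exp (-(2 * 0.56271755)) ≤ Real.exp (-(2 * z)) := Real.exp_le_exp.2 (by linarith)
  have hw : height 3 - 0.56271755 ≤ height 3 - z := by linarith
  have hβ : 0 ≤ -2 / 395 + 8 / 395 * unit3 := by linarith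
  have hδ : 0 ≤ 68651 / 20000 - 6241 / 5000 * unit3 := by linarith
  have hVβ := mul_le_mul_of_nonneg_left hV hβ
  have hUδ := mul_le_mul_of_nonneg_left hU hδ
  have hC := mul_le_mul (pow_le_pow_left₀ (mul_nonneg hE0.le (by linarith))
    (mul_le_mul hE.2.le (show (237 / 125 - 237 / 500 * unit3 + (-2 / 395 + 8 / 395 * unit3) * Real.exp (-(2 * 0.56271755))) -
      0.79 * (11 - 4 * unit3) ≤ (0.254 : ℝ) by linarith) (by linarith) (by norm_num)) 2)
    e.wu (bern_pos _).le (by norm_num)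
  exact sqDistCeil_mono hw (by linarith) (by linarith) (by linarith) (by linarith)
    (hC.trans (le_trans (by norm_num) (by linarith : 0.3997 ≤ height 3 - 0.56271755)))

/-- The radius is both the floor and the ceiling distance of the centre; whichever side of
0.56271755 the height falls on, one of the two is already large enough. -/
theorem le_sq_of_isCircumsphere {c : Sol} {r : ℝ}
    (h : IsCircumsphere (tetrahedron 0.79 0.2 3 4) c r) : 0.6463087012 ≤ r ^ 2 := by
  rw [tetrahedron_eq] at h
  obtain ⟨-, h⟩ := h
  have hc : c = mk c.x c.y c.z := rfl
  have hQτ := congrArg (· ^ 2) (h 0)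
  have hQ := congrArg (· ^ 2) (h 1)
  have hP' := congrArg (· ^ 2) (h 2)
  have hP := congrArg (· ^ 2) (h 3)
  simp only [Matrix.cons_val] at hQτ hQ hP' hP
  rw [hc, transDist_ceil_sq, exp_height_three] at hQτ
  rw [hc, transDist_floor_sq] at hQ hP' hP
  obtain ⟨hX, hY⟩ := axis_of_equidistant (hQ.trans hP'.symm) (hQ.trans hP.symm)
  rw [hX, hY] at hQ hQτ
  rcases le_total 0.56271755 c.z with hz | hz
  · exact hQ ▸ le_axisFloor_of_le hz
  · exact hQτ ▸ le_axisCeil_of_le hz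

/-! ### Bracketing the largest circumradius -/

theorem exists_circumsphere_tetrahedron (i : Fin 6) : ∃ c r,
    IsCircumsphere (tetrahedron 0.79 0.2 3 i) c r ∧ r ^ 2 ≤ 0.6463087201 := by
  have weaken : ∀ j : Fin 6, (∃ c r, IsCircumsphere (tetrahedron 0.79 0.2 3 j) c r ∧
      r ^ 2 ≤ 0.645) → ∃ c r, IsCircumsphere (tetrahedron 0.79 0.2 3 j) c r ∧
      r ^ 2 ≤ 0.6463087201 := fun j ⟨c, r, h, h'⟩ => ⟨c, r, h, h'.trans (by norm_num)⟩
  fin_cases i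
  exacts [weaken 0 exists_circumsphere_tetrahedron_0, weaken 1 exists_circumsphere_tetrahedron_1,
    weaken 2 exists_circumsphere_tetrahedron_2, weaken 3 exists_circumsphere_tetrahedron_3,
    exists_circumsphere_tetrahedron_4, weaken 5 exists_circumsphere_tetrahedron_5]

theorem bddBelow_circumradii (A : Fin 4 → Sol) : BddBelow {r : ℝ | ∃ c, IsCircumsphere A c r} :=
  ⟨0, fun _ ⟨_, h⟩ => h.1.le⟩

theorem maxCircumradius_le : maxCircumradius 0.79 0.2 3 ≤ Real.sqrt 0.6463087201 := by
  refine Finset.sup'_le _ _ fun i _ => ?_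
  obtain ⟨c, r, h, h'⟩ := exists_circumsphere_tetrahedron i
  exact (csInf_le (bddBelow_circumradii _) ⟨c, h⟩).trans (Real.le_sqrt_of_sq_le h')

theorem le_maxCircumradius : Real.sqrt 0.6463087012 ≤ maxCircumradius 0.79 0.2 3 := by
  refine le_trans ?_ (Finset.le_sup' (fun i : Fin 6 => circumradius (tetrahedron 0.79 0.2 3 i))
    (Finset.mem_univ 4))
  -- Existence matters here: without it the infimum would be the default value `sInf ∅ = 0`.
  obtain ⟨c, r, h, -⟩ := exists_circumsphere_tetrahedron 4
  refine le_csInf ⟨r, c, h⟩ fun s ⟨d, hs⟩ => ?_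
  exact (Real.sqrt_le_left hs.1.le).2 (le_sq_of_isCircumsphere hs)

theorem maxCircumradius_bounds :
    0.8039332691 ≤ maxCircumradius 0.79 0.2 3 ∧ maxCircumradius 0.79 0.2 3 ≤ 0.8039332810 :=
  ⟨(Real.le_sqrt_of_sq_le (by norm_num)).trans le_maxCircumradius,
   maxCircumradius_le.trans (Real.sqrt_le_iff.2 ⟨by norm_num, by norm_num⟩)⟩

theorem maxCircumradius_pos : 0 < maxCircumradius 0.79 0.2 3 :=
  lt_of_lt_of_le (by norm_num) maxCircumradius_bounds.1

/-! ### The lattice as the set of points with integer coordinates -/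

/-- The point of `Γ(t₁, t₂, 3)` with integer coordinates `m`, `n`, `k`. -/
noncomputable def latticePoint (t₁ t₂ : ℝ) (m n k : ℤ) : Sol :=
  mk (t₁ * (m + n * (3 - unit3))) (t₂ * (m + n * unit3)) (k * height 3)

/-- E is a unit of ℤ[E], and x/t₁ and y/t₂ are the two conjugate embeddings of m + nE. A vertical
translation multiplies by E^k, which permutes ℤ[E]. -/
theorem exists_int_scale (k : ℤ) : ∀ m n : ℤ, ∃ m' n' : ℤ,
    (m + n * (3 - unit3)) * Real.exp (-(k * height 3)) = m' + n' * (3 - unit3) ∧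
    (m + n * unit3) * Real.exp (k * height 3) = m' + n' * unit3 := by
  have hE := unit3_sq
  induction k using Int.induction_on with
  | zero => exact fun m n => ⟨m, n, by simp, by simp⟩
  | succ k ih =>
    intro m n
    -- (m + nE)E = -n + (m + 3n)E.
    obtain ⟨m', n', h1, h2⟩ := ih (-n) (m + 3 * n)
    refine ⟨m', n', h1 ▸ ?_, h2 ▸ ?_⟩
    · rw [show (-(((k + 1 : ℤ) : ℝ) * height 3)) = -height 3 + -(((k : ℤ) : ℝ) * height 3) by
        push_cast; ring, Real.exp_add, exp_neg_height_three, ← mul_assoc]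
      congr 1
      push_cast
      linear_combination (n : ℝ) * hE
    · rw [show (((k + 1 : ℤ) : ℝ) * height 3) = height 3 + ((k : ℤ) : ℝ) * height 3 by
        push_cast; ring, Real.exp_add, exp_height_three, ← mul_assoc]
      congr 1
      push_cast
      linear_combination (n : ℝ) * hE
  | pred k ih =>
    intro m n
    -- (m + nE)E⁻¹ = (3m + n) - mE.
    obtain ⟨m', n', h1, h2⟩ := ih (3 * m + n) (-m)
    refine ⟨m', n', h1 ▸ ?_, h2 ▸ ?_⟩
    · rw [show (-(((-k - 1 : ℤ) : ℝ) * height 3)) = height 3 + -(((-k : ℤ) : ℝ) * height 3) by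
        push_cast; ring, Real.exp_add, exp_height_three, ← mul_assoc]
      congr 1
      push_cast
      linear_combination (-(n : ℝ)) * hE
    · rw [show (((-k - 1 : ℤ) : ℝ) * height 3) = -height 3 + ((-k : ℤ) : ℝ) * height 3 by
        push_cast; ring, Real.exp_add, exp_neg_height_three, ← mul_assoc]
      congr 1
      push_cast
      linear_combination (-(n : ℝ)) * hE

theorem latticePoint_zero (t₁ t₂ : ℝ) : latticePoint t₁ t₂ 0 0 0 = 1 := by
  apply ext' <;> simp [latticePoint, mk, x, y, z] <;> rfl

/-- The subgroup of all points with integer coordinates. -/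
noncomputable def integerPoints (t₁ t₂ : ℝ) : Subgroup Sol where
  carrier := {p | ∃ m n k : ℤ, p = latticePoint t₁ t₂ m n k}
  one_mem' := ⟨0, 0, 0, (latticePoint_zero t₁ t₂).symm⟩
  mul_mem' := by
    rintro _ _ ⟨m, n, k, rfl⟩ ⟨m', n', k', rfl⟩
    obtain ⟨a, b, h1, h2⟩ := exists_int_scale k' m n
    refine ⟨m' + a, n' + b, k' + k, ?_⟩
    rw [latticePoint, latticePoint, mk_mul_mk, latticePoint]
    rw [mul_assoc t₁ _ (Real.exp _), mul_assoc t₂ _ (Real.exp _), h1, h2]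
    congr 1 <;> push_cast <;> ring
  inv_mem' := by
    rintro _ ⟨m, n, k, rfl⟩
    obtain ⟨a, b, h1, h2⟩ := exists_int_scale (-k) m n
    refine ⟨-a, -b, -k, ?_⟩
    change mk (-(t₁ * _) * Real.exp (k * height 3)) (-(t₂ * _) * Real.exp (-(k * height 3)))
      (-(k * height 3)) = _
    push_cast at h1 h2
    rw [neg_mul, neg_neg] at h1
    rw [neg_mul] at h2
    rw [neg_mul, neg_mul, mul_assoc t₁, mul_assoc t₂, h1, h2, latticePoint]
    congr 1 <;> push_cast <;> ring

theorem mk_floor_zpow (a b : ℝ) (n : ℤ) : mk a b 0 ^ n = mk (n * a) (n * b) 0 := by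
  induction n using Int.induction_on with
  | zero => simp; rfl
  | succ n ih =>
    rw [zpow_add_one, ih, mk_floor_mul_mk_floor]
    congr 1 <;> push_cast <;> ring
  | pred n ih =>
    rw [zpow_sub_one, ih, mul_inv_eq_iff_eq_mul, mk_floor_mul_mk_floor]
    congr 1 <;> push_cast <;> ring

theorem tau₃_zpow (n : ℤ) : tau₃ 3 ^ n = mk 0 0 (n * height 3) := by
  have h : ∀ c d : ℝ, mk 0 0 c * mk 0 0 d = mk 0 0 (d + c) := fun c d => by
    rw [mk_mul_mk]; simp
  induction n using Int.induction_on with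
  | zero => simp; rfl
  | succ n ih =>
    rw [zpow_add_one, ih, tau₃, h]
    congr 1; push_cast; ring
  | pred n ih =>
    rw [zpow_sub_one, ih, mul_inv_eq_iff_eq_mul, tau₃, h]
    congr 1; push_cast; ring

/-- The power of `tau₃` stands on the left because right multiplication by a horizontal element adds
its coordinates unscaled. -/
theorem latticePoint_eq (t₁ t₂ : ℝ) (m n k : ℤ) : latticePoint t₁ t₂ m n k =
    tau₃ 3 ^ k * (tau₁ t₁ t₂ ^ m * tau₂ t₁ t₂ 3 ^ n) := by
  rw [tau₃_zpow, tau₁, tau₂, mk_floor_zpow, mk_floor_zpow, mk_floor_mul_mk_floor, mk_mul_mk,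
    exp_height_three, exp_neg_height_three, latticePoint]
  congr 1 <;> ring

theorem fundLattice_eq (t₁ t₂ : ℝ) : fundLattice t₁ t₂ 3 = integerPoints t₁ t₂ := by
  apply le_antisymm
  · rw [fundLattice, Subgroup.closure_le]
    rintro p (rfl | rfl | rfl)
    · exact ⟨1, 0, 0, by simp [latticePoint_eq]⟩
    · exact ⟨0, 1, 0, by simp [latticePoint_eq]⟩
    · exact ⟨0, 0, 1, by simp [latticePoint_eq]⟩
  · rintro _ ⟨m, n, k, rfl⟩
    rw [latticePoint_eq]
    have h1 : tau₁ t₁ t₂ ∈ fundLattice t₁ t₂ 3 := Subgroup.subset_closure (by simp)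
    have h2 : tau₂ t₁ t₂ 3 ∈ fundLattice t₁ t₂ 3 := Subgroup.subset_closure (by simp)
    have h3 : tau₃ 3 ∈ fundLattice t₁ t₂ 3 := Subgroup.subset_closure (by simp)
    exact mul_mem (zpow_mem h3 k) (mul_mem (zpow_mem h1 m) (zpow_mem h2 n))

theorem mem_fundLattice {t₁ t₂ : ℝ} {p : Sol} :
    p ∈ fundLattice t₁ t₂ 3 ↔ ∃ m n k : ℤ, p = latticePoint t₁ t₂ m n k := by
  rw [fundLattice_eq]; rfl

theorem height_three_pos : 0 < height 3 := by linarith [height_three_bounds.1]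

theorem sqrt_five_pos : 0 < Real.sqrt 5 := by positivity

theorem unit3_sub_conj : unit3 - (3 - unit3) = Real.sqrt 5 := by unfold unit3; ring

/-! ### The fundamental parallelepiped, discreteness and cocompactness -/

/-- The coordinates of the horizontal part of a point in the basis `tau₁`, `tau₂`. -/
noncomputable def coordTau₂ (t₁ t₂ : ℝ) (p : Sol) : ℝ := (p.y / t₂ - p.x / t₁) / Real.sqrt 5

noncomputable def coordTau₁ (t₁ t₂ : ℝ) (p : Sol) : ℝ :=
  p.x / t₁ - coordTau₂ t₁ t₂ p * (3 - unit3)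

theorem x_eq_coord {t₁ : ℝ} (t₂ : ℝ) (h₁ : t₁ ≠ 0) (p : Sol) :
    p.x = t₁ * (coordTau₁ t₁ t₂ p + coordTau₂ t₁ t₂ p * (3 - unit3)) := by
  unfold coordTau₁
  field_simp
  ring

theorem y_eq_coord (t₁ : ℝ) {t₂ : ℝ} (h₂ : t₂ ≠ 0) (p : Sol) :
    p.y = t₂ * (coordTau₁ t₁ t₂ p + coordTau₂ t₁ t₂ p * unit3) := by
  have h5 := sqrt_five_pos.ne'
  have h : coordTau₂ t₁ t₂ p * Real.sqrt 5 = p.y / t₂ - p.x / t₁ := by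
    unfold coordTau₂
    field_simp
  have h' : p.y = t₂ * (p.y / t₂) := by field_simp
  rw [← unit3_sub_conj] at h
  unfold coordTau₁
  linear_combination h' - t₂ * h

theorem coord_of_eq {t₁ t₂ : ℝ} (h₁ : t₁ ≠ 0) (h₂ : t₂ ≠ 0) {p : Sol} {s t : ℝ}
    (hx : p.x = t₁ * (s + t * (3 - unit3))) (hy : p.y = t₂ * (s + t * unit3)) :
    coordTau₁ t₁ t₂ p = s ∧ coordTau₂ t₁ t₂ p = t := by
  have h5 := sqrt_five_pos.ne'
  have h : coordTau₂ t₁ t₂ p = t := by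
    rw [coordTau₂, hx, hy, div_eq_iff h5, ← unit3_sub_conj]
    field_simp
    ring
  refine ⟨?_, h⟩
  rw [coordTau₁, h, hx]
  field_simp
  ring

theorem coord_mul_latticePoint {t₁ t₂ : ℝ} (h₁ : t₁ ≠ 0) (h₂ : t₂ ≠ 0) (p : Sol) (m n k : ℤ) :
    coordTau₁ t₁ t₂ (p * latticePoint t₁ t₂ m n k) =
      m + coordTau₁ t₁ t₂ (p * latticePoint t₁ t₂ 0 0 k) ∧
    coordTau₂ t₁ t₂ (p * latticePoint t₁ t₂ m n k) =
      n + coordTau₂ t₁ t₂ (p * latticePoint t₁ t₂ 0 0 k) := by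
  set q := p * latticePoint t₁ t₂ 0 0 k with hq
  have hqx : q.x = p.x * Real.exp (-(k * height 3)) := by
    change t₁ * _ + p.x * Real.exp (-(k * height 3)) = _
    simp
  have hqy : q.y = p.y * Real.exp (k * height 3) := by
    change t₂ * _ + p.y * Real.exp (k * height 3) = _
    simp
  apply coord_of_eq h₁ h₂
  · change t₁ * (m + n * (3 - unit3)) + p.x * Real.exp (-(k * height 3)) = _
    rw [← hqx, x_eq_coord t₂ h₁ q]
    ring
  · change t₂ * (m + n * unit3) + p.y * Real.exp (k * height 3) = _
    rw [← hqy, y_eq_coord t₁ h₂ q]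
    ring

/-- The half-open parallelepiped spanned by `tau₁`, `tau₂`, `tau₃`. -/
def fundParallelepiped (t₁ t₂ : ℝ) : Set Sol :=
  {p | coordTau₁ t₁ t₂ p ∈ Set.Ico (0 : ℝ) 1 ∧ coordTau₂ t₁ t₂ p ∈ Set.Ico (0 : ℝ) 1 ∧
    p.z ∈ Set.Ico 0 (height 3)}

theorem int_add_mem_Ico {m : ℤ} {s : ℝ} : (m : ℝ) + s ∈ Set.Ico (0 : ℝ) 1 ↔ m = -⌊s⌋ := by
  rw [eq_neg_iff_add_eq_zero, ← Int.floor_intCast_add, Int.floor_eq_zero_iff]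

/-- The height fixes k; after the vertical translation by k, m and n act as plain integer shifts of
the coordinates. This gives at once existence and uniqueness of the representative in the half-open
box. -/
theorem mul_latticePoint_mem {t₁ t₂ : ℝ} (h₁ : t₁ ≠ 0) (h₂ : t₂ ≠ 0) (p : Sol) (m n k : ℤ) :
    p * latticePoint t₁ t₂ m n k ∈ fundParallelepiped t₁ t₂ ↔
      m = -⌊coordTau₁ t₁ t₂ (p * latticePoint t₁ t₂ 0 0 k)⌋ ∧
      n = -⌊coordTau₂ t₁ t₂ (p * latticePoint t₁ t₂ 0 0 k)⌋ ∧ k = -⌊p.z / height 3⌋ := by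
  have hh := height_three_pos
  obtain ⟨e1, e2⟩ := coord_mul_latticePoint h₁ h₂ p m n k
  have e3 : (p * latticePoint t₁ t₂ m n k).z = (k + p.z / height 3) * height 3 := by
    change k * height 3 + p.z = _
    field_simp
  have e4 : ∀ s : ℝ, s * height 3 ∈ Set.Ico 0 (height 3) ↔ s ∈ Set.Ico (0 : ℝ) 1 := fun s => by
    constructor
    · rintro ⟨a, b⟩
      exact ⟨nonneg_of_mul_nonneg_left a hh, by nlinarith⟩
    · rintro ⟨a, b⟩
      exact ⟨by positivity, by nlinarith⟩
  simp only [fundParallelepiped, Set.mem_ofPred_eq, e1, e2, e3, e4, int_add_mem_Ico]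

theorem latticePoint_injective {t₁ t₂ : ℝ} (h₁ : t₁ ≠ 0) (h₂ : t₂ ≠ 0) {m n k m' n' k' : ℤ}
    (h : latticePoint t₁ t₂ m n k = latticePoint t₁ t₂ m' n' k') :
    m = m' ∧ n = n' ∧ k = k' := by
  have e := fun m n k : ℤ => coord_of_eq (p := latticePoint t₁ t₂ m n k) h₁ h₂ (s := m) (t := n)
    rfl rfl
  have hz : (k : ℝ) * height 3 = k' * height 3 := congrArg Sol.z h
  have h1 := (e m n k).1.symm.trans ((congrArg _ h).trans (e m' n' k').1)
  have h2 := (e m n k).2.symm.trans ((congrArg _ h).trans (e m' n' k').2)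
  exact ⟨by exact_mod_cast h1, by exact_mod_cast h2,
    by exact_mod_cast mul_right_cancel₀ height_three_pos.ne' hz⟩

theorem continuous_x : Continuous Sol.x := (continuous_fst : Continuous fun p : ℝ × ℝ × ℝ => p.1)
theorem continuous_y : Continuous Sol.y :=
  (continuous_fst.comp continuous_snd : Continuous fun p : ℝ × ℝ × ℝ => p.2.1)
theorem continuous_z : Continuous Sol.z :=
  (continuous_snd.comp continuous_snd : Continuous fun p : ℝ × ℝ × ℝ => p.2.2)

theorem continuous_coordTau₂ (t₁ t₂ : ℝ) : Continuous (coordTau₂ t₁ t₂) :=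
  ((continuous_y.div_const _).sub (continuous_x.div_const _)).div_const _

theorem continuous_coordTau₁ (t₁ t₂ : ℝ) : Continuous (coordTau₁ t₁ t₂) :=
  (continuous_x.div_const _).sub ((continuous_coordTau₂ t₁ t₂).mul_const _)

theorem discreteTopology_fundLattice {t₁ t₂ : ℝ} (h₁ : t₁ ≠ 0) (h₂ : t₂ ≠ 0) :
    DiscreteTopology (fundLattice t₁ t₂ 3) := by
  rw [discreteTopology_iff_isOpen_singleton]
  rintro ⟨p, hp⟩
  obtain ⟨m, n, k, rfl⟩ := mem_fundLattice.1 hp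
  have hh := height_three_pos
  refine ⟨{q | |coordTau₁ t₁ t₂ q - m| < 1 ∧ |coordTau₂ t₁ t₂ q - n| < 1 ∧
    |q.z - k * height 3| < height 3}, ?_, ?_⟩
  · refine IsOpen.inter ?_ (IsOpen.inter ?_ ?_)
    · exact isOpen_lt ((continuous_coordTau₁ t₁ t₂).sub continuous_const).abs continuous_const
    · exact isOpen_lt ((continuous_coordTau₂ t₁ t₂).sub continuous_const).abs continuous_const
    · exact isOpen_lt (continuous_z.sub continuous_const).abs continuous_const
  · ext ⟨q, hq⟩
    obtain ⟨m', n', k', rfl⟩ := mem_fundLattice.1 hq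
    have e := fun m n k : ℤ => coord_of_eq (p := latticePoint t₁ t₂ m n k) h₁ h₂ (s := m)
      (t := n) rfl rfl
    have e3 : (latticePoint t₁ t₂ m' n' k').z = k' * height 3 := rfl
    simp only [Set.mem_preimage, Set.mem_ofPred_eq, Set.mem_singleton_iff, Subtype.mk.injEq,
      (e m' n' k').1, (e m' n' k').2, e3, ← sub_mul, abs_mul, abs_of_pos hh]
    constructor
    · rintro ⟨a, b, c⟩
      have c' : |(k' : ℝ) - k| < 1 := by nlinarith
      have a' : |m' - m| < 1 := by exact_mod_cast a
      have b' : |n' - n| < 1 := by exact_mod_cast b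
      have c'' : |k' - k| < 1 := by exact_mod_cast c'
      rw [Int.abs_lt_one_iff, sub_eq_zero] at a' b' c''
      rw [a', b', c'']
    · intro h
      obtain ⟨rfl, rfl, rfl⟩ := latticePoint_injective h₁ h₂ h
      simpa using hh

theorem exists_mul_mem_fundParallelepiped {t₁ t₂ : ℝ} (h₁ : t₁ ≠ 0) (h₂ : t₂ ≠ 0) (p : Sol) :
    ∃ g ∈ fundLattice t₁ t₂ 3, p * g ∈ fundParallelepiped t₁ t₂ := by
  have h := (mul_latticePoint_mem h₁ h₂ p _ _ _).2 ⟨rfl, rfl, rfl⟩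
  exact ⟨_, mem_fundLattice.2 ⟨_, _, _, rfl⟩, h⟩

theorem isLattice_fundLattice {t₁ t₂ : ℝ} (h₁ : t₁ ≠ 0) (h₂ : t₂ ≠ 0) :
    IsLattice (fundLattice t₁ t₂ 3) := by
  refine ⟨⟨_, _, _, rfl⟩, discreteTopology_fundLattice h₁ h₂,
    (fun v : ℝ × ℝ × ℝ => mk (t₁ * (v.1 + v.2.1 * (3 - unit3))) (t₂ * (v.1 + v.2.1 * unit3)) v.2.2)
      '' (Set.Icc 0 1 ×ˢ Set.Icc 0 1 ×ˢ Set.Icc 0 (height 3)), ?_, fun p => ?_⟩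
  · apply (isCompact_Icc.prod (isCompact_Icc.prod isCompact_Icc)).image
    change Continuous fun v : ℝ × ℝ × ℝ =>
      ((t₁ * (v.1 + v.2.1 * (3 - unit3)), t₂ * (v.1 + v.2.1 * unit3), v.2.2) : ℝ × ℝ × ℝ)
    fun_prop
  · obtain ⟨g, hg, hs, ht, hz⟩ := exists_mul_mem_fundParallelepiped h₁ h₂ p
    refine ⟨g, hg, (_, _, _),
      ⟨Set.Ico_subset_Icc_self hs, Set.Ico_subset_Icc_self ht, Set.Ico_subset_Icc_self hz⟩, ?_⟩
    exact ext' (x_eq_coord t₂ h₁ _).symm (y_eq_coord t₁ h₂ _).symm rfl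

/-! ### Invariance of the volume and the covolume -/

open MeasureTheory

theorem volume_triple_eq_lintegral {s : Set (ℝ × ℝ × ℝ)} (hs : MeasurableSet s) :
    volume s = ∫⁻ c : ℝ, volume {v : ℝ × ℝ | (v.1, v.2, c) ∈ s} := by
  have h : (volume : Measure (ℝ × ℝ × ℝ)) = Measure.map MeasurableEquiv.prodAssoc
      ((volume.prod volume : Measure (ℝ × ℝ)).prod volume) := Measure.prodAssoc_prod.symm
  rw [h, MeasurableEquiv.map_apply, Measure.prod_apply_symm
    (MeasurableEquiv.prodAssoc.measurable hs)]
  rfl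

theorem volume_eq_lintegral_slices {s : Set Sol} (hs : MeasurableSet s) :
    volume s = ∫⁻ c : ℝ, volume {v : ℝ × ℝ | mk v.1 v.2 c ∈ s} :=
  volume_triple_eq_lintegral hs

/-- The linear map of the plane with matrix `!![a, b; c, d]`. -/
noncomputable def planeMap (a b c d : ℝ) : ℝ × ℝ →ₗ[ℝ] ℝ × ℝ :=
  Matrix.toLin (Module.Basis.finTwoProd ℝ) (Module.Basis.finTwoProd ℝ) !![a, b; c, d]

theorem planeMap_apply (a b c d : ℝ) (v : ℝ × ℝ) :
    planeMap a b c d v = (a * v.1 + b * v.2, c * v.1 + d * v.2) := by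
  rw [planeMap, Matrix.toLin_finTwoProd_apply]

theorem det_planeMap (a b c d : ℝ) : LinearMap.det (planeMap a b c d) = a * d - b * c := by
  rw [planeMap, LinearMap.det_toLin, Matrix.det_fin_two_of]

theorem measurable_mk_mul (g : Sol) : Measurable fun p : Sol => p * g := by
  change Measurable fun p : ℝ × ℝ × ℝ => ((g.x + p.1 * Real.exp (-g.z),
    g.y + p.2.1 * Real.exp g.z, g.z + p.2.2) : ℝ × ℝ × ℝ)
  fun_prop

instance : MeasurableConstSMul Solᵐᵒᵖ Sol := ⟨fun g => measurable_mk_mul g.unop⟩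

/-- The linear part is diagonal with entries e^{-d}, e^d, 1, of determinant 1. -/
theorem volume_preimage_affine (a b c d : ℝ) (s : Set (ℝ × ℝ × ℝ)) :
    volume ((fun p : ℝ × ℝ × ℝ =>
      (a + p.1 * Real.exp (-d), b + p.2.1 * Real.exp d, c + p.2.2)) ⁻¹' s) = volume s := by
  set f : ℝ × ℝ × ℝ →ₗ[ℝ] ℝ × ℝ × ℝ :=
    (LinearMap.mulLeft ℝ (Real.exp (-d))).prodMap
      ((LinearMap.mulLeft ℝ (Real.exp d)).prodMap LinearMap.id) with hf
  have hdet : LinearMap.det f = 1 := by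
    rw [hf, LinearMap.det_prodMap, LinearMap.det_prodMap, LinearMap.det_ring, LinearMap.det_ring]
    simp [← Real.exp_add]
  have e : (fun p : ℝ × ℝ × ℝ =>
      (a + p.1 * Real.exp (-d), b + p.2.1 * Real.exp d, c + p.2.2)) ⁻¹' s =
      f ⁻¹' ((fun q : ℝ × ℝ × ℝ => (a, b, c) + q) ⁻¹' s) := by
    ext p
    simp [hf, mul_comm]
  have : (volume : Measure (ℝ × ℝ × ℝ)).IsAddHaarMeasure :=
    Measure.prod.instIsAddHaarMeasure volume volume
  rw [e, Measure.addHaar_preimage_linearMap _ (by rw [hdet]; exact one_ne_zero), hdet]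
  simp only [inv_one, abs_one, ENNReal.ofReal_one, one_mul]
  exact measure_preimage_add volume (a, b, c) s

theorem volume_preimage_mul_right (g : Sol) (s : Set Sol) :
    volume ((fun p : Sol => p * g) ⁻¹' s) = volume s :=
  volume_preimage_affine g.x g.y g.z g.z s

instance (Γ : Subgroup Sol) : SMulInvariantMeasure Γ.op Sol volume :=
  ⟨fun g s _ => volume_preimage_mul_right (g : Solᵐᵒᵖ).unop s⟩

theorem measurable_coordTau₂ (t₁ t₂ : ℝ) : Measurable (coordTau₂ t₁ t₂) := by
  change Measurable fun p : ℝ × ℝ × ℝ => (p.2.1 / t₂ - p.1 / t₁) / Real.sqrt 5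
  fun_prop

theorem measurable_coordTau₁ (t₁ t₂ : ℝ) : Measurable (coordTau₁ t₁ t₂) := by
  change Measurable fun p : ℝ × ℝ × ℝ => p.1 / t₁ -
    (p.2.1 / t₂ - p.1 / t₁) / Real.sqrt 5 * (3 - unit3)
  fun_prop

theorem measurable_z : Measurable Sol.z :=
  (measurable_snd.comp measurable_snd : Measurable fun p : ℝ × ℝ × ℝ => p.2.2)

theorem measurableSet_fundParallelepiped (t₁ t₂ : ℝ) :
    MeasurableSet (fundParallelepiped t₁ t₂) :=
  (measurable_coordTau₁ t₁ t₂ measurableSet_Ico).inter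
    ((measurable_coordTau₂ t₁ t₂ measurableSet_Ico).inter (measurable_z measurableSet_Ico))

theorem volume_fundParallelepiped {t₁ t₂ : ℝ} (h₁ : t₁ ≠ 0) (h₂ : t₂ ≠ 0) :
    volume (fundParallelepiped t₁ t₂) =
      ENNReal.ofReal (|t₁ * t₂ * Real.sqrt 5| * height 3) := by
  have h5 := sqrt_five_pos.ne'
  rw [volume_eq_lintegral_slices (measurableSet_fundParallelepiped t₁ t₂)]
  have hslice : ∀ c : ℝ, volume {v : ℝ × ℝ | mk v.1 v.2 c ∈ fundParallelepiped t₁ t₂} =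
      (Set.Ico 0 (height 3)).indicator
        (fun _ => ENNReal.ofReal |t₁ * t₂ * Real.sqrt 5|) c := by
    intro c
    by_cases hc : c ∈ Set.Ico 0 (height 3)
    · rw [Set.indicator_of_mem hc]
      have e : {v : ℝ × ℝ | mk v.1 v.2 c ∈ fundParallelepiped t₁ t₂} =
          -- The matrix takes (x, y) to the coordinates in the basis `tau₁`, `tau₂`; its determinant
          -- is 1/(t₁t₂√5), as √5 is E minus its conjugate.
          planeMap (1 / t₁ + (3 - unit3) / (t₁ * Real.sqrt 5)) (-(3 - unit3) / (t₂ * Real.sqrt 5))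
            (-1 / (t₁ * Real.sqrt 5)) (1 / (t₂ * Real.sqrt 5)) ⁻¹'
            (Set.Ico (0 : ℝ) 1 ×ˢ Set.Ico (0 : ℝ) 1) := by
        ext v
        have e2 : coordTau₂ t₁ t₂ (mk v.1 v.2 c) =
            -1 / (t₁ * Real.sqrt 5) * v.1 + 1 / (t₂ * Real.sqrt 5) * v.2 := by
          change (v.2 / t₂ - v.1 / t₁) / Real.sqrt 5 = _
          field_simp
          ring
        have e1 : coordTau₁ t₁ t₂ (mk v.1 v.2 c) =
            (1 / t₁ + (3 - unit3) / (t₁ * Real.sqrt 5)) * v.1 +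
              -(3 - unit3) / (t₂ * Real.sqrt 5) * v.2 := by
          rw [coordTau₁, e2]
          change v.1 / t₁ - _ = _
          field_simp
          ring
        rw [Set.mem_preimage, planeMap_apply, Set.mem_prod, ← e1, ← e2]
        constructor
        · rintro ⟨a, b, -⟩
          exact ⟨a, b⟩
        · rintro ⟨a, b⟩
          exact ⟨a, b, hc⟩
      have hdet : LinearMap.det (planeMap (1 / t₁ + (3 - unit3) / (t₁ * Real.sqrt 5))
          (-(3 - unit3) / (t₂ * Real.sqrt 5)) (-1 / (t₁ * Real.sqrt 5))
          (1 / (t₂ * Real.sqrt 5))) = (t₁ * t₂ * Real.sqrt 5)⁻¹ := by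
        rw [det_planeMap]
        field_simp
        ring
      rw [e, Measure.addHaar_preimage_linearMap _ (by rw [hdet]; positivity), hdet, inv_inv,
        Measure.volume_eq_prod, Measure.prod_prod]
      simp
    · rw [Set.indicator_of_notMem hc]
      convert measure_empty (μ := volume)
      ext v
      exact iff_of_false (fun h => hc h.2.2) (by simp)
  simp only [hslice]
  rw [lintegral_indicator measurableSet_Ico, setLIntegral_const, Real.volume_Ico, sub_zero,
    ← ENNReal.ofReal_mul (abs_nonneg _)]

theorem isFundamentalDomain_fundParallelepiped {t₁ t₂ : ℝ} (h₁ : t₁ ≠ 0) (h₂ : t₂ ≠ 0) :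
    IsFundamentalDomain (fundLattice t₁ t₂ 3).op (fundParallelepiped t₁ t₂) volume := by
  refine IsFundamentalDomain.mk' (measurableSet_fundParallelepiped t₁ t₂).nullMeasurableSet
    fun p => ?_
  obtain ⟨g, hg, hp⟩ := exists_mul_mem_fundParallelepiped h₁ h₂ p
  refine ⟨⟨MulOpposite.op g, hg⟩, hp, ?_⟩
  rintro ⟨g', hg'⟩ hp'
  obtain ⟨m, n, k, rfl⟩ := mem_fundLattice.1 hg
  obtain ⟨m', n', k', e⟩ := mem_fundLattice.1 (show g'.unop ∈ _ from hg')
  change p * g'.unop ∈ _ at hp'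
  rw [e] at hp'
  obtain ⟨rfl, rfl, rfl⟩ := (mul_latticePoint_mem h₁ h₂ p _ _ _).1 hp
  obtain ⟨rfl, rfl, rfl⟩ := (mul_latticePoint_mem h₁ h₂ p _ _ _).1 hp'
  exact Subtype.ext (MulOpposite.unop_injective e)

theorem countable_fundLattice (t₁ t₂ : ℝ) : Countable (fundLattice t₁ t₂ 3) := by
  have h : Function.Surjective fun v : ℤ × ℤ × ℤ =>
      (⟨latticePoint t₁ t₂ v.1 v.2.1 v.2.2, mem_fundLattice.2 ⟨_, _, _, rfl⟩⟩ :
        fundLattice t₁ t₂ 3) := by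
    rintro ⟨p, hp⟩
    obtain ⟨m, n, k, rfl⟩ := mem_fundLattice.1 hp
    exact ⟨(m, n, k), rfl⟩
  exact h.countable

theorem covolume_fundLattice {t₁ t₂ : ℝ} (h₁ : t₁ ≠ 0) (h₂ : t₂ ≠ 0) :
    covolume (fundLattice t₁ t₂ 3).op Sol volume =
      ENNReal.ofReal (|t₁ * t₂ * Real.sqrt 5| * height 3) := by
  have := countable_fundLattice t₁ t₂
  have : Countable (fundLattice t₁ t₂ 3).op := (Subgroup.equivOp _).symm.injective.countable
  rw [(isFundamentalDomain_fundParallelepiped h₁ h₂).covolume_eq_volume,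
    volume_fundParallelepiped h₁ h₂]

/-! ### The covering -/

/-- The left side is convex in w, so its maximum is at w = ±h/2, where e^w is the golden ratio
1.618… or its inverse 0.618…. -/
theorem exp_mul_add_exp_mul_le {w a b c : ℝ} (ha : 0 ≤ a) (hb : 0 ≤ b)
    (hw : |w| ≤ height 3 / 2) (hab : a * 1.6181 + b * 0.6181 ≤ c)
    (hba : a * 0.6181 + b * 1.6181 ≤ c) : Real.exp w * a + Real.exp (-w) * b ≤ c := by
  have hφ : Real.exp (height 3 / 2) ≤ 1.6181 := by
    have h : Real.exp (height 3 / 2) ^ 2 = unit3 := by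
      rw [← Real.exp_nat_mul, ← exp_height_three]
      congr 1
      push_cast
      ring
    have := unit3_bounds.2
    exact le_of_sq_le_sq (by rw [h]; linarith) (by norm_num)
  obtain ⟨hw1, hw2⟩ := abs_le.1 hw
  have h1 : Real.exp w ≤ 1.6181 := (Real.exp_le_exp.2 hw2).trans hφ
  have h2 : Real.exp (-w) ≤ 1.6181 := (Real.exp_le_exp.2 (by linarith)).trans hφ
  have h3 : Real.exp w * Real.exp (-w) = 1 := by rw [← Real.exp_add]; simp
  -- Expanding (1.6181 - e^w)(1.6181 - e^{-w}) ≥ 0 bounds the sum by 1.6181 + 1/1.6181.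
  have h4 : Real.exp w + Real.exp (-w) ≤ 2.2362 := by
    nlinarith [mul_nonneg (sub_nonneg.2 h1) (sub_nonneg.2 h2)]
  rcases le_total a b with hle | hle
  · nlinarith [mul_le_mul_of_nonneg_left h4 ha,
      mul_le_mul_of_nonneg_left h2 (sub_nonneg.2 hle)]
  · nlinarith [mul_le_mul_of_nonneg_left h4 hb,
      mul_le_mul_of_nonneg_left h1 (sub_nonneg.2 hle)]

/-- Jensen's inequality: the convex integrand lies above its tangent at t = 1/2, whose mean over [0,
1] is the value at the midpoint. -/
theorem exp_half_le_expAvg (s : ℝ) : Real.exp (s / 2) ≤ expAvg s := by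
  have h : ∫ t in (0 : ℝ)..1, Real.exp (s / 2) * (1 + s * (t - 1 / 2)) = Real.exp (s / 2) := by
    rw [intervalIntegral.integral_const_mul, intervalIntegral.integral_add (by simp)
      ((by fun_prop : Continuous fun t : ℝ => s * (t - 1 / 2)).intervalIntegrable _ _),
      intervalIntegral.integral_const_mul, intervalIntegral.integral_sub (by simp) (by simp)]
    norm_num
  rw [← integral_exp_mul, ← h]
  apply intervalIntegral.integral_mono_on zero_le_one
  · exact (by fun_prop : Continuous fun t : ℝ =>
      Real.exp (s / 2) * (1 + s * (t - 1 / 2))).intervalIntegrable _ _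
  · exact (by fun_prop : Continuous fun t : ℝ => Real.exp (s * t)).intervalIntegrable _ _
  · intro t _
    rw [show s * t = s / 2 + s * (t - 1 / 2) by ring, Real.exp_add]
    exact mul_le_mul_of_nonneg_left (by linarith [Real.add_one_le_exp (s * (t - 1 / 2))])
      (Real.exp_pos _).le

theorem bern_sq_le (s : ℝ) : bern s ^ 2 ≤ Real.exp (-s) := by
  have h : bern s ≤ Real.exp (-(s / 2)) := by
    rw [Real.exp_neg]
    exact inv_anti₀ (Real.exp_pos _) (exp_half_le_expAvg s)
  refine (pow_le_pow_left₀ (bern_pos s).le h 2).trans (le_of_eq ?_)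
  rw [← Real.exp_nat_mul]
  congr 1
  push_cast
  ring

theorem transDist_mul_right (p q g : Sol) : transDist (p * g) (q * g) = transDist p q := by
  refine (pow_left_inj₀ (transDist_nonneg _ _) (transDist_nonneg _ _) two_ne_zero).1 ?_
  rw [transDist_sq, transDist_sq]
  have hz : ∀ r : Sol, (r * g).z = g.z + r.z := fun _ => rfl
  have hx : ∀ r : Sol, (r * g).x = g.x + r.x * Real.exp (-g.z) := fun _ => rfl
  have hy : ∀ r : Sol, (r * g).y = g.y + r.y * Real.exp g.z := fun _ => rfl
  have h1 : Real.exp (-g.z) * Real.exp g.z = 1 := by rw [← Real.exp_add]; simp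
  have e1 : ((q * g).x - (p * g).x) * Real.exp (p * g).z = (q.x - p.x) * Real.exp p.z := by
    rw [hx, hx, hz, Real.exp_add]
    linear_combination (q.x - p.x) * Real.exp p.z * h1
  have e2 : ((q * g).y - (p * g).y) * Real.exp (-(p * g).z) = (q.y - p.y) * Real.exp (-p.z) := by
    rw [hy, hy, hz, neg_add, Real.exp_add]
    linear_combination (q.y - p.y) * Real.exp (-p.z) * h1
  rw [e1, e2, hz, hz, add_sub_add_left_eq_sub, add_sub_add_left_eq_sub]

/-- By `bern_sq_le` the squared distance is at most e^{z}Δx² + e^{-z}Δy² + z². Rounding is done in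
the basis `tau₁ * tau₂⁻¹`, `tau₂`, whose coordinates are s and s + t; it balances Δx and Δy better
than the original basis. -/
theorem exists_floor_point_near {q : Sol} (hq : |q.z| ≤ height 3 / 2) :
    ∃ m n : ℤ, transDist (latticePoint 0.79 0.2 m n 0) q ^ 2 ≤ 0.63 := by
  have hE := unit3_bounds
  set s := coordTau₁ 0.79 0.2 q
  set t := coordTau₂ 0.79 0.2 q
  have hx : q.x = 0.79 * (s + t * (3 - unit3)) := x_eq_coord 0.2 (by norm_num) q
  have hy : q.y = 0.2 * (s + t * unit3) := y_eq_coord 0.79 (by norm_num) q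
  obtain ⟨a1, a2⟩ := abs_le.1 (abs_sub_round s)
  obtain ⟨b1, b2⟩ := abs_le.1 (abs_sub_round (s + t))
  set m := round s
  set n := round (s + t)
  refine ⟨m, n - m, ?_⟩
  rw [transDist_sq]
  change ((q.x - 0.79 * (m + ((n - m : ℤ) : ℝ) * (3 - unit3))) * Real.exp (((0 : ℤ) : ℝ) * height 3)
      * bern (((0 : ℤ) : ℝ) * height 3 - q.z)) ^ 2 +
    ((q.y - 0.2 * (m + ((n - m : ℤ) : ℝ) * unit3)) * Real.exp (-(((0 : ℤ) : ℝ) * height 3))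
      * bern (q.z - ((0 : ℤ) : ℝ) * height 3)) ^ 2 + (q.z - ((0 : ℤ) : ℝ) * height 3) ^ 2 ≤ _
  push_cast
  simp only [zero_mul, neg_zero, Real.exp_zero, mul_one, zero_sub, sub_zero]
  -- With rounding errors a and b, Δx = 0.79(a(E - 2) + b(3 - E)), and the two weights sum to 1;
  -- likewise Δy = 0.2(a(1 - E) + bE), at most 0.1(2E - 1).
  have hX : (q.x - 0.79 * (m + (n - m) * (3 - unit3))) ^ 2 ≤ 0.395 ^ 2 := by
    refine sq_le_sq.2 ((abs_le.2 ?_).trans (le_abs_self _))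
    rw [hx]
    constructor <;> nlinarith
  have hY : (q.y - 0.2 * (m + (n - m) * unit3)) ^ 2 ≤ 0.4237 ^ 2 := by
    refine sq_le_sq.2 ((abs_le.2 ?_).trans (le_abs_self _))
    rw [hy]
    constructor <;> nlinarith
  have h1 := bern_sq_le (-q.z)
  rw [neg_neg] at h1
  have h2 := bern_sq_le q.z
  have h3 : q.z ^ 2 ≤ 0.4813 ^ 2 :=
    sq_le_sq.2 ((hq.trans (by linarith [height_three_bounds.2])).trans (le_abs_self _))
  have h4 := exp_mul_add_exp_mul_le (a := 0.395 ^ 2) (b := 0.4237 ^ 2) (c := 0.3872)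
    (by norm_num) (by norm_num) hq (by norm_num) (by norm_num)
  rw [mul_pow, mul_pow]
  have h5 := mul_le_mul hX h1 (sq_nonneg _) (by norm_num)
  have h6 := mul_le_mul hY h2 (sq_nonneg _) (by norm_num)
  linarith

theorem covers_fundLattice {R : ℝ} (hR : 0.8039332691 ≤ R) :
    Covers (fundLattice 0.79 0.2 3) R := by
  have hh := height_three_pos
  refine Set.eq_univ_of_forall fun p => ?_
  set k := round (p.z / height 3)
  set g := latticePoint 0.79 0.2 0 0 (-k) with hg
  have hz : |(p * g).z| ≤ height 3 / 2 := by
    have e : (p * g).z = (p.z / height 3 - k) * height 3 := by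
      change (((-k : ℤ) : ℝ)) * height 3 + p.z = _
      push_cast
      field_simp
      ring
    rw [e, abs_mul, abs_of_pos hh]
    have := mul_le_mul_of_nonneg_right (abs_sub_round (p.z / height 3)) hh.le
    linarith
  obtain ⟨m, n, hmn⟩ := exists_floor_point_near hz
  have hmem : latticePoint 0.79 0.2 m n 0 * g⁻¹ ∈ fundLattice 0.79 0.2 3 :=
    mul_mem (mem_fundLattice.2 ⟨_, _, _, rfl⟩) (inv_mem (mem_fundLattice.2 ⟨_, _, _, rfl⟩))
  refine Set.mem_iUnion₂.2 ⟨_, hmem, ?_⟩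
  change transDist _ p ≤ R
  rw [← transDist_mul_right _ _ g, inv_mul_cancel_right]
  refine le_of_sq_le_sq (hmn.trans ?_) (by linarith)
  nlinarith

/-! ### The volume of a translation ball -/

theorem measurable_bern : Measurable bern := bern_antitone.measurable

theorem mem_transBall_one {R : ℝ} (hR : 0 ≤ R) {p : Sol} : p ∈ transBall 1 R ↔
    (bern (-p.z) * p.x) ^ 2 + (bern p.z * p.y) ^ 2 ≤ R ^ 2 - p.z ^ 2 := by
  have h : transDist 1 p ^ 2 = (bern (-p.z) * p.x) ^ 2 + (bern p.z * p.y) ^ 2 + p.z ^ 2 := by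
    rw [transDist_sq]
    change ((p.x - 0) * Real.exp 0 * bern (0 - p.z)) ^ 2 +
      ((p.y - 0) * Real.exp (-0) * bern (p.z - 0)) ^ 2 + (p.z - 0) ^ 2 = _
    simp only [sub_zero, zero_sub, neg_zero, Real.exp_zero]
    ring
  change transDist 1 p ≤ R ↔ _
  rw [← sq_le_sq₀ (transDist_nonneg _ _) hR, h, le_sub_iff_add_le]

theorem measurable_x : Measurable Sol.x := (measurable_fst : Measurable fun p : ℝ × ℝ × ℝ => p.1)
theorem measurable_y : Measurable Sol.y :=
  (measurable_fst.comp measurable_snd : Measurable fun p : ℝ × ℝ × ℝ => p.2.1)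

theorem measurableSet_transBall_one {R : ℝ} (hR : 0 ≤ R) : MeasurableSet (transBall 1 R) := by
  have e : transBall 1 R = {p : Sol | (bern (-p.z) * p.x) ^ 2 + (bern p.z * p.y) ^ 2 ≤
      R ^ 2 - p.z ^ 2} := Set.ext fun p => mem_transBall_one hR
  rw [e]
  have hx := measurable_x
  have hy := measurable_y
  have hz := measurable_z
  have h1 : Measurable fun p : Sol => bern (-p.z) := measurable_bern.comp hz.neg
  have h2 : Measurable fun p : Sol => bern p.z := measurable_bern.comp hz
  exact measurableSet_le (((h1.mul hx).pow_const 2).add ((h2.mul hy).pow_const 2))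
    (measurable_const.sub (hz.pow_const 2))

theorem volume_disc {ρ : ℝ} (hρ : 0 ≤ ρ) :
    volume {v : ℝ × ℝ | v.1 ^ 2 + v.2 ^ 2 ≤ ρ} = ENNReal.ofReal (Real.pi * ρ) := by
  have h := Complex.volume_preserving_equiv_real_prod.measure_preimage_equiv
    {v : ℝ × ℝ | v.1 ^ 2 + v.2 ^ 2 ≤ ρ}
  have e : Complex.measurableEquivRealProd ⁻¹' {v : ℝ × ℝ | v.1 ^ 2 + v.2 ^ 2 ≤ ρ} =
      Metric.closedBall (0 : ℂ) (Real.sqrt ρ) := by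
    ext w
    simp only [Set.mem_preimage, Set.mem_ofPred_eq, Complex.measurableEquivRealProd_apply,
      mem_closedBall_zero_iff]
    rw [Real.le_sqrt (norm_nonneg _) hρ, Complex.sq_norm, Complex.normSq_apply, sq, sq]
  rw [← h, e, Complex.volume_closedBall, ← ENNReal.ofReal_pow (Real.sqrt_nonneg _),
    Real.sq_sqrt hρ, mul_comm, ENNReal.ofReal_mul Real.pi_pos.le]
  congr 1
  exact (ENNReal.ofReal_coe_nnreal (p := NNReal.pi)).symm

theorem volume_ellipse {a b ρ : ℝ} (ha : 0 < a) (hb : 0 < b) (hρ : 0 ≤ ρ) :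
    volume {v : ℝ × ℝ | (a * v.1) ^ 2 + (b * v.2) ^ 2 ≤ ρ} =
      ENNReal.ofReal (Real.pi * ρ * (a⁻¹ * b⁻¹)) := by
  have e : {v : ℝ × ℝ | (a * v.1) ^ 2 + (b * v.2) ^ 2 ≤ ρ} =
      planeMap a 0 0 b ⁻¹' {v : ℝ × ℝ | v.1 ^ 2 + v.2 ^ 2 ≤ ρ} := by
    ext v
    simp [planeMap_apply]
  have hdet : LinearMap.det (planeMap a 0 0 b) = a * b := by rw [det_planeMap]; ring
  rw [e, Measure.addHaar_preimage_linearMap _ (by rw [hdet]; positivity), volume_disc hρ, hdet,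
    ← ENNReal.ofReal_mul (abs_nonneg _), abs_of_pos (by positivity), mul_inv]
  congr 1
  ring

theorem continuous_expAvg_mul_expAvg_neg : Continuous fun c => expAvg c * expAvg (-c) := by
  have h : Continuous expAvg := by
    have e : expAvg = fun s => ∫ t in (0 : ℝ)..1, Real.exp (s * t) :=
      funext fun s => (integral_exp_mul s).symm
    rw [e]
    exact intervalIntegral.continuous_parametric_intervalIntegral_of_continuous' (by fun_prop) _ _
  exact h.mul (h.comp continuous_neg)

/-- Cavalieri: the slice at height c is an ellipse whose axis factors are the reciprocals of `bern
(-c)` and `bern c`. -/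
theorem volume_transBall_one {R : ℝ} (hR : 0 ≤ R) : volume (transBall 1 R) =
    ENNReal.ofReal (∫ c in -R..R, Real.pi * (R ^ 2 - c ^ 2) * (expAvg c * expAvg (-c))) := by
  have hcont : Continuous fun c => Real.pi * (R ^ 2 - c ^ 2) * (expAvg c * expAvg (-c)) :=
    (by fun_prop : Continuous fun c : ℝ => Real.pi * (R ^ 2 - c ^ 2)).mul
      continuous_expAvg_mul_expAvg_neg
  have hsq : ∀ c ∈ Set.Ioc (-R) R, 0 ≤ R ^ 2 - c ^ 2 := fun c hc => by
    nlinarith [hc.1, hc.2]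
  rw [intervalIntegral.integral_of_le (by linarith),
    ofReal_integral_eq_lintegral_ofReal (hcont.integrableOn_Ioc),
    ← lintegral_indicator measurableSet_Ioc,
    volume_eq_lintegral_slices (measurableSet_transBall_one hR)]
  · apply lintegral_congr_ae
    -- The height -R is discarded because the interval integral runs over a half-open interval.
    filter_upwards [compl_mem_ae_iff.2 (measure_singleton (-R) (μ := volume))] with c hc
    have e : {v : ℝ × ℝ | mk v.1 v.2 c ∈ transBall 1 R} =
        {v : ℝ × ℝ | (bern (-c) * v.1) ^ 2 + (bern c * v.2) ^ 2 ≤ R ^ 2 - c ^ 2} :=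
      Set.ext fun v => mem_transBall_one hR
    rw [e]
    by_cases h : c ∈ Set.Ioc (-R) R
    · rw [Set.indicator_of_mem h, volume_ellipse (bern_pos _) (bern_pos _) (hsq c h)]
      simp only [bern, inv_inv]
      rw [mul_comm (expAvg (-c))]
    · rw [Set.indicator_of_notMem h]
      convert measure_empty (μ := volume)
      refine Set.eq_empty_of_forall_notMem fun v hv => h ?_
      have h1 : c ^ 2 ≤ R ^ 2 := by
        have := hv.out
        nlinarith [sq_nonneg (bern (-c) * v.1), sq_nonneg (bern c * v.2)]
      obtain ⟨h2, h3⟩ := abs_le.1 (abs_le_of_sq_le_sq h1 hR)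
      exact ⟨lt_of_le_of_ne h2 (Ne.symm hc), h3⟩
  · refine (ae_restrict_iff' measurableSet_Ioc).2 (Filter.Eventually.of_forall fun c hc => ?_)
    exact mul_nonneg (mul_nonneg Real.pi_pos.le (hsq c hc))
      (mul_pos (expAvg_pos _) (expAvg_pos _)).le

theorem expAvg_mul_expAvg_neg {c : ℝ} (hc : c ≠ 0) :
    expAvg c * expAvg (-c) * c ^ 2 = Real.exp c + Real.exp (-c) - 2 := by
  have h : Real.exp c * Real.exp (-c) = 1 := by rw [← Real.exp_add]; simp
  rw [expAvg, expAvg, if_neg hc, if_neg (neg_ne_zero.2 hc)]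
  field_simp
  linear_combination -h

/-- Taylor polynomial of `expAvg c * expAvg (-c) = (2 cosh c - 2) / c²`. -/
noncomputable def areaTaylor (c : ℝ) : ℝ :=
  ∑ k ∈ Finset.range 5, 2 / ((2 * k + 2).factorial : ℝ) * c ^ (2 * k)

/-- Multiplied by c², the error is the sum of the order-12 Taylor remainders of e^c and e^{-c}, the
odd terms cancelling. Bounding |c|¹² by c² makes division by c² possible. -/
theorem abs_expAvg_mul_sub_areaTaylor_le {c : ℝ} (hc : |c| ≤ 1) :
    |expAvg c * expAvg (-c) - areaTaylor c| ≤ 1e-8 := by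
  by_cases h0 : c = 0
  · subst h0
    norm_num [expAvg, areaTaylor, Finset.sum_range_succ, Nat.factorial]
  have h1 := Real.exp_bound hc (n := 12) (by norm_num)
  have h2 := Real.exp_bound (x := -c) (by rwa [abs_neg]) (n := 12) (by norm_num)
  rw [abs_neg] at h2
  have h3 := expAvg_mul_expAvg_neg h0
  have e : (expAvg c * expAvg (-c) - areaTaylor c) * c ^ 2 =
      (Real.exp c - ∑ m ∈ Finset.range 12, c ^ m / m.factorial) +
      (Real.exp (-c) - ∑ m ∈ Finset.range 12, (-c) ^ m / m.factorial) := by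
    rw [sub_mul, h3, areaTaylor]
    simp only [Finset.sum_range_succ, Finset.sum_range_zero, Nat.factorial]
    push_cast
    ring
  have h4 : |expAvg c * expAvg (-c) - areaTaylor c| * c ^ 2 ≤ 1e-8 * c ^ 2 := by
    rw [← abs_of_nonneg (sq_nonneg c), ← abs_mul, abs_of_nonneg (sq_nonneg c), e]
    refine (abs_add_le _ _).trans ((add_le_add h1 h2).trans ?_)
    have h5 : |c| ^ 12 ≤ c ^ 2 := by
      rw [← sq_abs c]
      exact pow_le_pow_of_le_one (abs_nonneg c) hc (by norm_num)
    have h6 : 0 ≤ c ^ 2 := sq_nonneg c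
    norm_num [Nat.factorial]
    linarith
  exact le_of_mul_le_mul_right h4 (by positivity)

theorem integral_moment (R : ℝ) (k : ℕ) : ∫ c in -R..R, (R ^ 2 - c ^ 2) * c ^ (2 * k) =
    4 * R ^ (2 * k + 3) / ((2 * k + 1) * (2 * k + 3)) := by
  have e : ∀ c : ℝ, (R ^ 2 - c ^ 2) * c ^ (2 * k) = R ^ 2 * c ^ (2 * k) - c ^ (2 * k + 2) :=
    fun c => by ring
  simp only [e]
  rw [intervalIntegral.integral_sub
    ((by fun_prop : Continuous fun c : ℝ => R ^ 2 * c ^ (2 * k)).intervalIntegrable _ _)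
    ((by fun_prop : Continuous fun c : ℝ => c ^ (2 * k + 2)).intervalIntegrable _ _),
    intervalIntegral.integral_const_mul, integral_pow, integral_pow]
  have o1 : (-R) ^ (2 * k + 1) = -R ^ (2 * k + 1) := Odd.neg_pow ⟨k, rfl⟩ R
  have o2 : (-R) ^ (2 * k + 2 + 1) = -R ^ (2 * k + 2 + 1) := Odd.neg_pow ⟨k + 1, by ring⟩ R
  rw [o1, o2]
  have h1 : (2 * (k : ℝ) + 1) ≠ 0 := by positivity
  have h3 : (2 * (k : ℝ) + 3) ≠ 0 := by positivity
  have h4 : (2 * (k : ℝ) + 2 + 1) ≠ 0 := by positivity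
  push_cast
  field_simp
  ring

theorem integral_areaTaylor (R δ : ℝ) :
    ∫ c in -R..R, Real.pi * (R ^ 2 - c ^ 2) * (areaTaylor c + δ) =
      Real.pi * (4 * δ * R ^ 3 / 3 + ∑ k ∈ Finset.range 5, 2 / ((2 * k + 2).factorial : ℝ) *
        (4 * R ^ (2 * k + 3) / ((2 * k + 1) * (2 * k + 3)))) := by
  have e : ∀ c : ℝ, Real.pi * (R ^ 2 - c ^ 2) * (areaTaylor c + δ) =
      Real.pi * (δ * ((R ^ 2 - c ^ 2) * c ^ (2 * 0)) + ∑ k ∈ Finset.range 5,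
        2 / ((2 * k + 2).factorial : ℝ) * ((R ^ 2 - c ^ 2) * c ^ (2 * k))) := fun c => by
    rw [areaTaylor, mul_assoc, mul_add, Finset.mul_sum, add_comm]
    congr 2
    · ring
    · exact Finset.sum_congr rfl fun k _ => by ring
  have hi : ∀ (a : ℝ) (k : ℕ), IntervalIntegrable
      (fun c : ℝ => a * ((R ^ 2 - c ^ 2) * c ^ (2 * k))) volume (-R) R := fun a k =>
    (by fun_prop : Continuous fun c : ℝ => a * ((R ^ 2 - c ^ 2) * c ^ (2 * k))).intervalIntegrable
      _ _
  simp only [e]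
  rw [intervalIntegral.integral_const_mul, intervalIntegral.integral_add (hi _ _)
    ((by fun_prop : Continuous fun c : ℝ => ∑ k ∈ Finset.range 5,
      2 / ((2 * k + 2).factorial : ℝ) * ((R ^ 2 - c ^ 2) * c ^ (2 * k))).intervalIntegrable _ _),
    intervalIntegral.integral_finsetSum fun k _ => hi _ _]
  simp only [intervalIntegral.integral_const_mul, integral_moment]
  norm_num
  ring

theorem integral_bounds {R : ℝ} (h0 : 0 ≤ R) (h1 : R ≤ 1) :
    (∫ c in -R..R, Real.pi * (R ^ 2 - c ^ 2) * (areaTaylor c + -1e-8)) ≤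
      (∫ c in -R..R, Real.pi * (R ^ 2 - c ^ 2) * (expAvg c * expAvg (-c))) ∧
    (∫ c in -R..R, Real.pi * (R ^ 2 - c ^ 2) * (expAvg c * expAvg (-c))) ≤
      ∫ c in -R..R, Real.pi * (R ^ 2 - c ^ 2) * (areaTaylor c + 1e-8) := by
  have hc1 : Continuous fun c => Real.pi * (R ^ 2 - c ^ 2) * (expAvg c * expAvg (-c)) :=
    (by fun_prop : Continuous fun c : ℝ => Real.pi * (R ^ 2 - c ^ 2)).mul
      continuous_expAvg_mul_expAvg_neg
  have hc2 : ∀ δ : ℝ, Continuous fun c => Real.pi * (R ^ 2 - c ^ 2) * (areaTaylor c + δ) :=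
    fun δ => by unfold areaTaylor; fun_prop
  have key : ∀ c ∈ Set.Icc (-R) R, 0 ≤ Real.pi * (R ^ 2 - c ^ 2) ∧
      |expAvg c * expAvg (-c) - areaTaylor c| ≤ 1e-8 := fun c hc =>
    ⟨mul_nonneg Real.pi_pos.le (by nlinarith [hc.1, hc.2]),
     abs_expAvg_mul_sub_areaTaylor_le ((abs_le.2 hc).trans h1)⟩
  constructor <;> refine intervalIntegral.integral_mono_on (by linarith)
    (Continuous.intervalIntegrable ?_ _ _) (Continuous.intervalIntegrable ?_ _ _) ?_
  · exact hc2 _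
  · exact hc1
  · intro c hc
    obtain ⟨k1, k2⟩ := key c hc
    exact mul_le_mul_of_nonneg_left (by linarith [(abs_le.1 k2).1]) k1
  · exact hc1
  · exact hc2 _
  · intro c hc
    obtain ⟨k1, k2⟩ := key c hc
    exact mul_le_mul_of_nonneg_left (by linarith [(abs_le.1 k2).2]) k1

/-- The coefficients are 2/(2k+2)! times 4/((2k+1)(2k+3)). The uniform error 10⁻⁸ integrates to
(4/3)·10⁻⁸ R³, rounded up to 2·10⁻⁸ R³. -/
theorem volume_transBall_one_toReal {R : ℝ} (h0 : 0 ≤ R) (h1 : R ≤ 1) :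
    Real.pi * ((4 / 3 - 2e-8) * R ^ 3 + R ^ 5 / 45 + R ^ 7 / 3150 + R ^ 9 / 317520 +
      R ^ 11 / 44906400) ≤ (volume (transBall 1 R)).toReal ∧
    (volume (transBall 1 R)).toReal ≤ Real.pi * ((4 / 3 + 2e-8) * R ^ 3 + R ^ 5 / 45 +
      R ^ 7 / 3150 + R ^ 9 / 317520 + R ^ 11 / 44906400) := by
  obtain ⟨hl, hu⟩ := integral_bounds h0 h1
  rw [integral_areaTaylor] at hl hu
  have h3 : 0 ≤ R ^ 3 := pow_nonneg h0 3
  have hpi := Real.pi_pos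
  have hl' : Real.pi * ((4 / 3 - 2e-8) * R ^ 3 + R ^ 5 / 45 + R ^ 7 / 3150 + R ^ 9 / 317520 +
      R ^ 11 / 44906400) ≤
      ∫ c in -R..R, Real.pi * (R ^ 2 - c ^ 2) * (expAvg c * expAvg (-c)) := by
    refine le_trans (mul_le_mul_of_nonneg_left ?_ hpi.le) hl
    norm_num [Finset.sum_range_succ, Nat.factorial]
    linarith
  have hu' : (∫ c in -R..R, Real.pi * (R ^ 2 - c ^ 2) * (expAvg c * expAvg (-c))) ≤
      Real.pi * ((4 / 3 + 2e-8) * R ^ 3 + R ^ 5 / 45 + R ^ 7 / 3150 + R ^ 9 / 317520 +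
      R ^ 11 / 44906400) := by
    refine le_trans hu (mul_le_mul_of_nonneg_left ?_ hpi.le)
    norm_num [Finset.sum_range_succ, Nat.factorial]
    linarith
  have hpos : 0 ≤ ∫ c in -R..R, Real.pi * (R ^ 2 - c ^ 2) * (expAvg c * expAvg (-c)) := by
    refine le_trans (mul_nonneg hpi.le ?_) hl'
    have : (0 : ℝ) ≤ 4 / 3 - 2e-8 := by norm_num
    positivity
  rw [volume_transBall_one h0, ENNReal.toReal_ofReal hpos]
  exact ⟨hl', hu'⟩

/-! ### Densities -/

theorem transBall_mono (c : Sol) {r R : ℝ} (h : r ≤ R) : transBall c r ⊆ transBall c R :=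
  fun _ hp => le_trans hp h

theorem density_nonneg (Γ : Subgroup Sol) (r : ℝ) : 0 ≤ density Γ r :=
  div_nonneg ENNReal.toReal_nonneg ENNReal.toReal_nonneg

theorem density_mono (Γ : Subgroup Sol) {r R : ℝ} (hR : 0 ≤ R) (h : r ≤ R) :
    density Γ r ≤ density Γ R := by
  -- Finiteness of the larger volume is needed, since `toReal` sends ∞ to 0.
  refine div_le_div_of_nonneg_right (ENNReal.toReal_mono ?_ (measure_mono (transBall_mono 1 h)))
    ENNReal.toReal_nonneg
  rw [volume_transBall_one hR]
  exact ENNReal.ofReal_ne_top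

/-- The minimal covering radius of Γ is at most R and density is monotone in the radius; of the
other members of the family only nonnegativity of their densities is used. -/
theorem optimalCoveringDensity_le {family : Set (Subgroup Sol)} {Γ : Subgroup Sol}
    (hΓ : Γ ∈ family) {R : ℝ} (hR : 0 < R) (h : Covers Γ R) :
    optimalCoveringDensity family ≤ density Γ R := by
  have hmin : minCoveringRadius Γ ≤ R := csInf_le ⟨0, fun _ hr => hr.1.le⟩ ⟨hR, h⟩
  refine (csInf_le ⟨0, ?_⟩ (Set.mem_image_of_mem _ hΓ)).trans (density_mono Γ hR.le hmin)
  rintro _ ⟨Γ', -, rfl⟩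
  exact density_nonneg _ _

/-- The ball volume is enclosed in [2.2001111, 2.2001124] and the covolume 0.158·√5·h to 10⁻¹¹,
which is enough for the tolerance 5·10⁻⁶ on the quotient. -/
theorem density_bounds {R : ℝ} (h₁ : 0.8039332691 ≤ R) (h₂ : R ≤ 0.8039332810) :
    |density (fundLattice 0.79 0.2 3) R - 6.47048| < 0.000005 := by
  have h0 : 0 ≤ R := le_trans (by norm_num) h₁
  obtain ⟨hl, hu⟩ := volume_transBall_one_toReal h0 (h₂.trans (by norm_num))
  have hs := sqrt_five_bounds
  have hh := height_three_bounds
  have hcov : (covolume (fundLattice 0.79 0.2 3).op Sol volume).toReal =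
      0.79 * 0.2 * Real.sqrt 5 * height 3 := by
    have h5 := sqrt_five_pos
    have hp := height_three_pos
    rw [covolume_fundLattice (by norm_num) (by norm_num), ENNReal.toReal_ofReal (by positivity),
      abs_of_pos (by positivity)]
  have c1 : 0.34002306336 ≤ 0.79 * 0.2 * Real.sqrt 5 * height 3 := by
    have := mul_le_mul hs.1.le hh.1.le (by norm_num) (Real.sqrt_nonneg 5)
    linarith
  have c2 : 0.79 * 0.2 * Real.sqrt 5 * height 3 ≤ 0.34002306337 := by
    have := mul_le_mul hs.2.le hh.2.le height_three_pos.le (by norm_num)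
    linarith
  have p1 := Real.pi_gt_d20
  have p2 := Real.pi_lt_d20
  have v1 : 2.2001111 ≤ (volume (transBall 1 R)).toReal := by
    refine le_trans ?_ hl
    have : (0.7003173 : ℝ) ≤ (4 / 3 - 2e-8) * R ^ 3 + R ^ 5 / 45 +
        R ^ 7 / 3150 + R ^ 9 / 317520 + R ^ 11 / 44906400 := by
      refine le_trans (b := (4 / 3 - 2e-8) * 0.8039332691 ^ 3 + 0.8039332691 ^ 5 / 45 +
        0.8039332691 ^ 7 / 3150 + 0.8039332691 ^ 9 / 317520 + 0.8039332691 ^ 11 / 44906400)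
        (by norm_num) ?_
      have : (0 : ℝ) ≤ 4 / 3 - 2e-8 := by norm_num
      gcongr
    nlinarith
  have v2 : (volume (transBall 1 R)).toReal ≤ 2.2001124 := by
    refine le_trans hu ?_
    have : (4 / 3 + 2e-8) * R ^ 3 + R ^ 5 / 45 +
        R ^ 7 / 3150 + R ^ 9 / 317520 + R ^ 11 / 44906400 ≤ 0.7003174 := by
      refine le_trans (b := (4 / 3 + 2e-8) * 0.8039332810 ^ 3 + 0.8039332810 ^ 5 / 45 +
        0.8039332810 ^ 7 / 3150 + 0.8039332810 ^ 9 / 317520 + 0.8039332810 ^ 11 / 44906400)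
        ?_ (by norm_num)
      gcongr
    have hp : 0 ≤ (4 / 3 + 2e-8) * R ^ 3 + R ^ 5 / 45 +
        R ^ 7 / 3150 + R ^ 9 / 317520 + R ^ 11 / 44906400 := by positivity
    nlinarith
  have hpos : 0 < 0.79 * 0.2 * Real.sqrt 5 * height 3 := lt_of_lt_of_le (by norm_num) c1
  rw [density, hcov, abs_lt, lt_sub_iff_add_lt, sub_lt_iff_lt_add, lt_div_iff₀ hpos,
    div_lt_iff₀ hpos]
  constructor <;> linarith

end Sol

theorem theorem3p4 :
    Sol.IsLattice (Sol.fundLattice 0.79 0.2 3) ∧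
    (∀ i : Fin 6, ∃ (c : Sol) (r : ℝ),
      Sol.IsCircumsphere (Sol.tetrahedron 0.79 0.2 3 i) c r) ∧
    Sol.Covers (Sol.fundLattice 0.79 0.2 3) (Sol.maxCircumradius 0.79 0.2 3) ∧
    Sol.optimalCoveringDensity {Γ | Sol.IsFundamentalLattice Γ} ≤
      Sol.density (Sol.fundLattice 0.79 0.2 3) (Sol.maxCircumradius 0.79 0.2 3) ∧
    Sol.optimalCoveringDensity {Γ | Sol.IsLattice Γ} ≤
      Sol.density (Sol.fundLattice 0.79 0.2 3) (Sol.maxCircumradius 0.79 0.2 3) ∧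
    |Sol.density (Sol.fundLattice 0.79 0.2 3) (Sol.maxCircumradius 0.79 0.2 3) - 6.47048|
      < 0.000005 := by
  have hlat : Sol.IsLattice (Sol.fundLattice 0.79 0.2 3) :=
    Sol.isLattice_fundLattice (by norm_num) (by norm_num)
  have hR := Sol.maxCircumradius_bounds
  have hpos := Sol.maxCircumradius_pos
  have hcov := Sol.covers_fundLattice hR.1
  refine ⟨hlat, fun i => ?_, hcov, Sol.optimalCoveringDensity_le ?_ hpos hcov,
    Sol.optimalCoveringDensity_le hlat hpos hcov, Sol.density_bounds hR.1 hR.2⟩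
  · obtain ⟨c, r, h, -⟩ := Sol.exists_circumsphere_tetrahedron i
    exact ⟨c, r, h⟩
  · exact ⟨0.79, 0.2, 3, by norm_num, by norm_num, le_rfl, rfl⟩
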